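/- **Notation.** For a semigroup $S$ with set of idempotents $E=E(S)$, a pair $(e,f)\in E\times E$ is *basic* if $\{e,f\}\cap\{ef,fe\}\neq\varnothing$. The free idempotent generated semigroup $\mathsf{IG}(\mathcal E)$ over the biordered set $\mathcal E$ of $S$ is the semigroup with generators $E$ and defining relations $e\cdot f=ef$ for all basic pairs $(e,f)$, where the right-hand side is a single generator, the product of $e$ and $f$ in $S$. The maximal subgroups of a semigroup are the $\mathscr H$-classes of its idempotents. **The band $B_{G,H}$.** Let $G$ be a finitely presented group and $H$ a finitely generated subgroup. Choose a finite presentation $G=\langle A\mid\mathcal R\rangle$ in which every relation has the form $ab=c$ with $a,b,c\in A$, and a subset $B\subseteq A$ that generates $H$ and satisfies $B^{-1}=B$ in $G$. Let $A_1=A\cup\{1\}$ and $B_1=B\cup\{1\}$, where $1$ is a new symbol, let $\overline{A_1}=\{\overline a: a\in A_1\}$ be a disjoint copy of $A_1$, and put $I=A_1\cup\overline{A_1}$ and $J=A_1\cup\{\infty\}$ with $\infty\notin A_1$. In the direct product of the semigroup of all maps $I\to I$ written on the left and the semigroup of all maps $J\to J$ written on the right, let $K_G$ be the set of pairs of constant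 maps, identified with $I\times J$, and let $K_H=A_1\times B_1\subseteq K_G$. For $s,t,x\in A_1$ let $(\sigma,\tau)_{s,t,x}$ be the pair in which $\sigma$ maps $A_1$ to $s$ and $\overline{A_1}$ to $\overline t$, and $\tau$ fixes $A_1$ pointwise and maps $\infty$ to $x$. Let $L_G$ consist of $e_a=(\sigma,\tau)_{1,a,a}$ and $e_{\overline a}=(\sigma,\tau)_{a,a,1}$ for $a\in A_1$, and $e_r=(\sigma,\tau)_{b,c,a}$ for each relation $r=(ab=c)$ in $\mathcal R$. Then $B_G=K_G\cup L_G$ is a semigroup with ideal $K_G$ and subsemigroup $K_H\cup L_G$. Let $B_G'$, $B_G''$ be disjoint copies of $B_G$ and let $W=B_G\cup B_G'\cup B_G''\cup\{0\}$ be the semigroup with zero $0$ extending the multiplications of $B_G,B_G',B_G''$ in which $st^{(i)}=s^{(i)}t=(st)^{(i)}$ and $s't''=s''t'=0$. Finally, $B_{G,H}$ is the subsemigroup $(K_H\cup L_G)\cup K_G'\cup K_G''\cup\{0\}$ of $W$. Write $\mathcal B_{G,H}$ for its biordered set of idempotents. **Theorem.** Let $G$ be a finitely presented group with decidable word problem and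 let $H$ be a finitely generated subgroup of $G$ with undecidable membership problem. Then a presentation of $G$ and a set $B$ as above exist and, for every such choice, $B_{G,H}$ is a finite band and $\mathsf{IG}(\mathcal B_{G,H})$ has the following properties: (i) every non-trivial maximal subgroup of $\mathsf{IG}(\mathcal B_{G,H})$ is isomorphic to $G$, and every maximal subgroup of $\mathsf{IG}(\mathcal B_{G,H})$ has decidable word problem; (ii) the semigroup $\mathsf{IG}(\mathcal B_{G,H})$ has undecidable word problem. -/

import Mathlib

universe u v

noncomputable section

/-! ### Decision problems -/

/-- A group has decidable word problem if it has a finite generating tuple `f` for which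
there is an algorithm deciding, given a word in the generators and their inverses (a list of
letters `(i, true)` for `f i` and `(i, false)` for `(f i)⁻¹`), whether it represents `1`. -/
def GroupDecidableWordProblem (G : Type u) [Group G] : Prop :=
  ∃ (n : ℕ) (f : Fin n → G), Subgroup.closure (Set.range f) = ⊤ ∧
    ComputablePred fun w : List (Fin n × Bool) =>
      FreeGroup.lift f (FreeGroup.mk w) = 1

/-- The membership problem for the subgroup `H` of the finitely generated group `G` is decidable:
there is an algorithm deciding, given a word in the generators of `G` and their inverses,
whether it represents an element of `H`. -/
def DecidableMembershipProblem {G : Type u} [Group G] (H : Subgroup G) : Prop :=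
  ∃ (n : ℕ) (f : Fin n → G), Subgroup.closure (Set.range f) = ⊤ ∧
    ComputablePred fun w : List (Fin n × Bool) =>
      FreeGroup.lift f (FreeGroup.mk w) ∈ H

/-- A semigroup has decidable word problem if it has a finite generating tuple `f` for which
there is an algorithm deciding whether two given nonempty words (a pair consisting of a first
letter and the list of the remaining letters) represent the same element. -/
def SemigroupDecidableWordProblem (S : Type u) [Semigroup S] : Prop :=
  ∃ (n : ℕ) (f : Fin n → S), Subsemigroup.closure (Set.range f) = ⊤ ∧
    ComputablePred fun p : (Fin n × List (Fin n)) × (Fin n × List (Fin n)) =>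
      FreeSemigroup.lift f ⟨p.1.1, p.1.2⟩ = FreeSemigroup.lift f ⟨p.2.1, p.2.2⟩

/-! ### Idempotents, free idempotent generated semigroups -/

/-- The set `E(S)` of idempotents of a semigroup. -/
abbrev Idempotents (S : Type u) [Semigroup S] : Type u := {e : S // IsIdempotentElem e}

/-- `(e, f)` is a basic pair: `{e, f} ∩ {ef, fe} ≠ ∅`. -/
def IsBasicPair {S : Type u} [Semigroup S] (e f : S) : Prop :=
  (({e, f} : Set S) ∩ {e * f, f * e}).Nonempty

/-- The defining relations `e f = g`, where `(e, f)` is a basic pair of idempotents of `S`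
and `g` is their product in `S` (which is an idempotent). -/
inductive IGRel (S : Type u) [Semigroup S] :
    FreeSemigroup (Idempotents S) → FreeSemigroup (Idempotents S) → Prop
  | basic (e f g : Idempotents S) (hb : IsBasicPair (e : S) (f : S))
      (hg : (e : S) * (f : S) = (g : S)) :
      IGRel S (FreeSemigroup.of e * FreeSemigroup.of f) (FreeSemigroup.of g)

/-- The free idempotent generated semigroup over the biordered set of idempotents of `S`:
the semigroup presented by the generators `E(S)` and the relations `IGRel`. -/
def IG (S : Type u) [Semigroup S] : Type u := (conGen (IGRel S)).Quotient

instance (S : Type u) [Semigroup S] : Semigroup (IG S) :=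
  inferInstanceAs (Semigroup (conGen (IGRel S)).Quotient)

/-! ### Green's relations and maximal subgroups -/

section Green

variable {S : Type u} [Semigroup S]

/-- The principal right ideal `a S¹`. -/
def principalRight (a : S) : Set S := {x | x = a ∨ ∃ s, x = a * s}

/-- The principal left ideal `S¹ a`. -/
def principalLeft (a : S) : Set S := {x | x = a ∨ ∃ s, x = s * a}

/-- Green's relation `R`. -/
def GreenR (a b : S) : Prop := principalRight a = principalRight b

/-- Green's relation `L`. -/
def GreenL (a b : S) : Prop := principalLeft a = principalLeft b

/-- Green's relation `H = R ∩ L`. -/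
def GreenH (a b : S) : Prop := GreenR a b ∧ GreenL a b

theorem greenH_iff (e : Idempotents S) (x : S) :
    GreenH x e ↔ (e : S) * x = x ∧ x * e = x ∧ ∃ y : S, (e : S) * y = y ∧ y * e = y ∧
      x * y = e ∧ y * x = e := by
  obtain ⟨e, he⟩ := e
  have he' : e * e = e := he
  constructor
  · rintro ⟨hR, hL⟩
    have h1 : x ∈ principalRight e := hR ▸ Or.inl rfl
    have h2 : e ∈ principalRight x := hR.symm ▸ Or.inl rfl
    have h3 : x ∈ principalLeft e := hL ▸ Or.inl rfl
    have h4 : e ∈ principalLeft x := hL.symm ▸ Or.inl rfl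
    have ex : e * x = x := by
      rcases h1 with h | ⟨s, h⟩
      · rw [h, he']
      · rw [h, ← mul_assoc, he']
    have xe : x * e = x := by
      rcases h3 with h | ⟨s, h⟩
      · rw [h, he']
      · rw [h, mul_assoc, he']
    obtain ⟨s, hs⟩ : ∃ s, x * s = e := by
      rcases h2 with h | ⟨s, h⟩
      · exact ⟨e, by rw [← h, he']⟩
      · exact ⟨s, h.symm⟩
    obtain ⟨t, ht⟩ : ∃ t, t * x = e := by
      rcases h4 with h | ⟨s, h⟩
      · exact ⟨e, by rw [← h, he']⟩
      · exact ⟨s, h.symm⟩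
    have hy : t * e = e * s := by
      calc t * e = t * (x * s) := by rw [hs]
        _ = e * s := by rw [← mul_assoc, ht]
    have hx1 : x * (e * s) = e := by rw [← mul_assoc, xe, hs]
    have hx2 : (e * s) * x = e := by rw [← hy, mul_assoc, ex, ht]
    refine ⟨ex, xe, e * s, ?_, ?_, hx1, hx2⟩
    · rw [← mul_assoc, he']
    · rw [← hy, mul_assoc, he']
  · rintro ⟨ex, xe, y, -, -, xy, yx⟩
    dsimp only at ex xe xy yx
    constructor
    · ext z
      constructor
      · rintro (h | ⟨s, h⟩)
        · exact Or.inr ⟨x, by rw [h]; exact ex.symm⟩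
        · exact Or.inr ⟨x * s, by rw [h, ← mul_assoc, ex]⟩
      · rintro (h | ⟨s, h⟩)
        · exact Or.inr ⟨y, by rw [h]; exact xy.symm⟩
        · exact Or.inr ⟨y * s, by rw [h, ← mul_assoc, xy]⟩
    · ext z
      constructor
      · rintro (h | ⟨s, h⟩)
        · exact Or.inr ⟨x, by rw [h]; exact xe.symm⟩
        · exact Or.inr ⟨s * x, by rw [h, mul_assoc, xe]⟩
      · rintro (h | ⟨s, h⟩)
        · exact Or.inr ⟨y, by rw [h]; exact yx.symm⟩
        · exact Or.inr ⟨s * y, by rw [h, mul_assoc, yx]⟩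

/-- The maximal subgroup of `S` with identity `e`: the `H`-class of the idempotent `e`.
Every maximal subgroup of `S` is of this form. -/
def MaximalSubgroup (e : Idempotents S) : Type u := {x : S // GreenH x e}

instance (e : Idempotents S) : Mul (MaximalSubgroup e) where
  mul x y := ⟨x.1 * y.1, by
    obtain ⟨a1, a2, a, a3, a4, a5, a6⟩ := (greenH_iff e x.1).1 x.2
    obtain ⟨b1, b2, b, b3, b4, b5, b6⟩ := (greenH_iff e y.1).1 y.2
    refine (greenH_iff e _).2 ⟨by rw [← mul_assoc, a1], by rw [mul_assoc, b2], b * a,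
      by rw [← mul_assoc, b3], by rw [mul_assoc, a4], ?_, ?_⟩
    · rw [mul_assoc, ← mul_assoc y.1, b5, a3, a5]
    · rw [mul_assoc, ← mul_assoc a, a6, b1, b6]⟩

instance (e : Idempotents S) : One (MaximalSubgroup e) where
  one := ⟨e, rfl, rfl⟩

instance (e : Idempotents S) : Inv (MaximalSubgroup e) where
  inv x := ⟨((greenH_iff e x.1).1 x.2).2.2.choose, by
    obtain ⟨h1, h2, h3, h4⟩ := ((greenH_iff e x.1).1 x.2).2.2.choose_spec
    obtain ⟨a1, a2, -⟩ := (greenH_iff e x.1).1 x.2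
    exact (greenH_iff e _).2 ⟨h1, h2, x.1, a1, a2, h4, h3⟩⟩

instance (e : Idempotents S) : Group (MaximalSubgroup e) :=
  Group.ofLeftAxioms
    (fun x y z => Subtype.ext (mul_assoc x.1 y.1 z.1))
    (fun x => Subtype.ext ((greenH_iff e x.1).1 x.2).1)
    (fun x => Subtype.ext ((greenH_iff e x.1).1 x.2).2.2.choose_spec.2.2.2)

end Green

/-! ### The constructions `W(S)` and `T(S, V, I)` -/

/-- `W(S) = S ∪ S' ∪ S'' ∪ {0}`. -/
inductive WSem (S : Type u) : Type u
  | base (s : S)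
  | prime (s : S)
  | dprime (s : S)
  | zero

namespace WSem

variable {S : Type u} [Semigroup S]

/-- `s t⁽ⁱ⁾ = s⁽ⁱ⁾ t = s⁽ⁱ⁾ t⁽ⁱ⁾ = (s t)⁽ⁱ⁾`, `s' t'' = s'' t' = 0`. -/
protected def mul : WSem S → WSem S → WSem S
  | base s, base t => base (s * t)
  | base s, prime t => prime (s * t)
  | prime s, base t => prime (s * t)
  | prime s, prime t => prime (s * t)
  | base s, dprime t => dprime (s * t)
  | dprime s, base t => dprime (s * t)
  | dprime s, dprime t => dprime (s * t)
  | prime _, dprime _ => zero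
  | dprime _, prime _ => zero
  | zero, _ => zero
  | _, zero => zero

instance : Mul (WSem S) := ⟨WSem.mul⟩

instance : Semigroup (WSem S) where
  mul_assoc a b c := by
    change WSem.mul (WSem.mul a b) c = WSem.mul a (WSem.mul b c)
    cases a <;> cases b <;> cases c <;> simp [WSem.mul, mul_assoc]

end WSem

/-- `T(S, V, I) = V ∪ I' ∪ I'' ∪ {0}` as a subsemigroup of `W(S)`, for a subsemigroup `V` and
an ideal `I` of `S`. -/
def TSem {S : Type u} [Semigroup S] (V : Subsemigroup S) (I : Set S)
    (hI : ∀ s : S, ∀ i ∈ I, s * i ∈ I ∧ i * s ∈ I) : Subsemigroup (WSem S) where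
  carrier := WSem.base '' (V : Set S) ∪ WSem.prime '' I ∪ WSem.dprime '' I ∪ {WSem.zero}
  mul_mem' := by
    rintro _ _ (((⟨s, hs, rfl⟩ | ⟨s, hs, rfl⟩) | ⟨s, hs, rfl⟩) | rfl)
      (((⟨t, ht, rfl⟩ | ⟨t, ht, rfl⟩) | ⟨t, ht, rfl⟩) | rfl)
    · exact Or.inl (Or.inl (Or.inl ⟨s * t, V.mul_mem hs ht, rfl⟩))
    · exact Or.inl (Or.inl (Or.inr ⟨s * t, (hI s t ht).1, rfl⟩))
    · exact Or.inl (Or.inr ⟨s * t, (hI s t ht).1, rfl⟩)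
    · exact Or.inr rfl
    · exact Or.inl (Or.inl (Or.inr ⟨s * t, (hI t s hs).2, rfl⟩))
    · exact Or.inl (Or.inl (Or.inr ⟨s * t, (hI s t ht).1, rfl⟩))
    · exact Or.inr rfl
    · exact Or.inr rfl
    · exact Or.inl (Or.inr ⟨s * t, (hI t s hs).2, rfl⟩)
    · exact Or.inr rfl
    · exact Or.inl (Or.inr ⟨s * t, (hI s t ht).1, rfl⟩)
    · exact Or.inr rfl
    · exact Or.inr rfl
    · exact Or.inr rfl
    · exact Or.inr rfl
    · exact Or.inr rfl

/-! ### The band `B_{G,H}` -/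

section Band

variable (A : Type v)

/-- `A₁ = A ∪ {1}`; the symbol `1` is `none`. -/
abbrev AOne : Type v := Option A

/-- `I = A₁ ∪ Ā₁`; `Sum.inl a` is `a` and `Sum.inr a` is `ā`. -/
abbrev RowIndex : Type v := AOne A ⊕ AOne A

/-- `J = A₁ ∪ {∞}`; `some a` is `a ∈ A₁` and `none` is `∞`. -/
abbrev ColIndex : Type v := Option (AOne A)

/-- The direct product of the semigroup of all mappings `I → I`, written on the left, and the
semigroup of all mappings `J → J`, written on the right. -/
abbrev BiTrans : Type v := Function.End (RowIndex A) × (Function.End (ColIndex A))ᵐᵒᵖ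

variable {A}

/-- The pair `(σ, τ)`, where `σ` maps `A₁` to `s` and `Ā₁` to `t̄`, and `τ` fixes `A₁` pointwise
and maps `∞` to `x`. -/
def lElt (s t x : AOne A) : BiTrans A :=
  ((Sum.elim (fun _ => Sum.inl s) (fun _ => Sum.inr t) : RowIndex A → RowIndex A),
    MulOpposite.op ((fun j => some (j.getD x)) : ColIndex A → ColIndex A))

/-- The pair of constant mappings with values `i` and `j`, identified with `(i, j) ∈ I × J`. -/
def kElt (i : RowIndex A) (j : ColIndex A) : BiTrans A :=
  ((fun _ => i : RowIndex A → RowIndex A),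
    MulOpposite.op (fun _ => j : ColIndex A → ColIndex A))

/-- The left zero band `L_G`. A triple `(a, b, c) ∈ R` stands for the relation `ab = c`. Its
elements are `e_a` (`im σ = {1, ā}`, `∞τ = a`), `e_ā` (`im σ = {a, ā}`, `∞τ = 1`) for `a ∈ A₁`,
and `e_r` (`im σ = {b, c̄}`, `∞τ = a`) for `r = (ab, c) ∈ R`. -/
def LG (R : Set (A × A × A)) : Set (BiTrans A) :=
  {x | (∃ a : AOne A, x = lElt none a a) ∨ (∃ a : AOne A, x = lElt a a none) ∨
    ∃ a b c : A, (a, b, c) ∈ R ∧ x = lElt (some b) (some c) (some a)}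

/-- The rectangular band `K_G = I × J` of all pairs of constant mappings. -/
def KG (A : Type v) : Set (BiTrans A) := {x | ∃ i j, x = kElt i j}

/-- `K_H = A₁ × B₁ ⊆ K_G`, where `B₁ = B ∪ {1}`. -/
def KH (B : Set A) : Set (BiTrans A) :=
  {x | ∃ a b : AOne A, (b = none ∨ ∃ b' ∈ B, b = some b') ∧ x = kElt (Sum.inl a) (some b)}

theorem kElt_mul_kElt (i k : RowIndex A) (j l : ColIndex A) :
    kElt i j * kElt k l = kElt i l := rfl

theorem lElt_mul_kElt (s t x : AOne A) (i : RowIndex A) (j : ColIndex A) :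
    lElt s t x * kElt i j = kElt (Sum.elim (fun _ => Sum.inl s) (fun _ => Sum.inr t) i) j := rfl

theorem kElt_mul_lElt (s t x : AOne A) (i : RowIndex A) (j : ColIndex A) :
    kElt i j * lElt s t x = kElt i (some (j.getD x)) := rfl

theorem lElt_mul_lElt (s t x s' t' x' : AOne A) :
    lElt s t x * lElt s' t' x' = lElt s t x := by
  refine Prod.ext ?_ rfl
  funext i
  cases i <;> rfl

theorem exists_lElt {R : Set (A × A × A)} {y : BiTrans A} (hy : y ∈ LG R) :
    ∃ s t x, y = lElt s t x := by
  rcases hy with ⟨a, rfl⟩ | ⟨a, rfl⟩ | ⟨a, b, c, -, rfl⟩ <;> exact ⟨_, _, _, rfl⟩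

/-- The band `B_G = K_G ∪ L_G`. -/
def BG (R : Set (A × A × A)) : Subsemigroup (BiTrans A) where
  carrier := KG A ∪ LG R
  mul_mem' := by
    rintro y z (⟨i, j, rfl⟩ | hy) (⟨k, l, rfl⟩ | hz)
    · exact Or.inl ⟨i, l, rfl⟩
    · obtain ⟨s, t, x, rfl⟩ := exists_lElt hz
      exact Or.inl ⟨_, _, kElt_mul_lElt s t x i j⟩
    · obtain ⟨s, t, x, rfl⟩ := exists_lElt hy
      exact Or.inl ⟨_, _, lElt_mul_kElt s t x k l⟩
    · obtain ⟨s, t, x, rfl⟩ := exists_lElt hy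
      obtain ⟨s', t', x', rfl⟩ := exists_lElt hz
      rw [lElt_mul_lElt]
      exact Or.inr hy

/-- The subband `K_H ∪ L_G` of `B_G`. -/
def KHLG (R : Set (A × A × A)) (B : Set A) : Subsemigroup (BG R) where
  carrier := {x | (x : BiTrans A) ∈ KH B ∪ LG R}
  mul_mem' := by
    rintro ⟨y, _⟩ ⟨z, _⟩ hy hz
    change y * z ∈ KH B ∪ LG R
    change y ∈ KH B ∪ LG R at hy
    change z ∈ KH B ∪ LG R at hz
    rcases hy with ⟨a, b, hb, rfl⟩ | hy <;> rcases hz with ⟨a', b', hb', rfl⟩ | hz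
    · exact Or.inl ⟨a, b', hb', rfl⟩
    · obtain ⟨s, t, x, rfl⟩ := exists_lElt hz
      exact Or.inl ⟨a, b, hb, rfl⟩
    · obtain ⟨s, t, x, rfl⟩ := exists_lElt hy
      exact Or.inl ⟨s, b', hb', rfl⟩
    · obtain ⟨s, t, x, rfl⟩ := exists_lElt hy
      obtain ⟨s', t', x', rfl⟩ := exists_lElt hz
      rw [lElt_mul_lElt]
      exact Or.inr hy

/-- `K_G` is an ideal of `B_G`. -/
theorem KG_ideal (R : Set (A × A × A)) (s : BG R) (i : BG R)
    (hi : i ∈ {x : BG R | (x : BiTrans A) ∈ KG A}) :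
    s * i ∈ {x : BG R | (x : BiTrans A) ∈ KG A} ∧
      i * s ∈ {x : BG R | (x : BiTrans A) ∈ KG A} := by
  obtain ⟨i, hi'⟩ := i
  obtain ⟨k, l, rfl⟩ := hi
  obtain ⟨s, ⟨m, n, rfl⟩ | hs⟩ := s
  · exact ⟨⟨m, l, rfl⟩, ⟨k, n, rfl⟩⟩
  · obtain ⟨a, b, x, rfl⟩ := exists_lElt hs
    exact ⟨⟨_, _, lElt_mul_kElt a b x k l⟩, ⟨_, _, kElt_mul_lElt a b x k l⟩⟩

/-- `B_{G,H} = T(B_G, K_H ∪ L_G, K_G)`. -/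
def BandGH (R : Set (A × A × A)) (B : Set A) : Subsemigroup (WSem (BG R)) :=
  TSem (KHLG R B) {x : BG R | (x : BiTrans A) ∈ KG A} (KG_ideal R)

end Band

/-- The data from which the band is built: a finite presentation `⟨A | R⟩` of the group `G` all of
whose relations have the form `ab = c` with `a, b, c ∈ A` (encoded as triples `(a, b, c)`),
together with a subset `B ⊆ A` with `B⁻¹ = B` in `G` that generates `H`. -/
structure TriangularPresentation (G : Type u) [Group G] (H : Subgroup G) where
  /-- the generators -/
  A : Type v
  finite_A : Finite A
  /-- the element of `G` represented by a generator -/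
  gen : A → G
  /-- the relations -/
  R : Set (A × A × A)
  gen_surjective : Function.Surjective (FreeGroup.lift gen)
  ker_eq : (FreeGroup.lift gen).ker = Subgroup.normalClosure
    {w | ∃ a b c : A, (a, b, c) ∈ R ∧
      w = FreeGroup.of a * FreeGroup.of b * (FreeGroup.of c)⁻¹}
  /-- the generators of `H` -/
  B : Set A
  inv_B : ∀ b ∈ B, ∃ b' ∈ B, gen b' = (gen b)⁻¹
  closure_B : Subgroup.closure (gen '' B) = H

/-- The band `B_{G,H}` of a pair `H ≤ G` (for the chosen presentation). -/
abbrev TriangularPresentation.Band {G : Type u} [Group G] {H : Subgroup G}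
    (P : TriangularPresentation.{u, v} G H) : Type v :=
  BandGH P.R P.B

end

/-! Each of `K_G'` and `K_G''` is a rectangular band, and `lElt s t x` fixes the rows s and t̄ while
sending column ∞ to column x, which yields a singular square. In `IG` these squares make each copy a
Rees matrix semigroup with matrix `sandwich`: e_a and e_ā determine the entries of column ∞, and e_r
for ab = c forces c⁻¹ = b⁻¹a⁻¹ (`invElt_relation`). So `G` maps to the group at (1, 1), and the copy
generates only elements with coordinates (i, g, j) (`groupHom`, `eq_coord`).

Between factors from different copies, elements of `K_H ∪ L_G` can pass from one side to the other.
For b in B, evaluating one product through e_b and through e_b̄ moves b across, so g'·1'' = 1'·g''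
for g in H (`emb_mul_base_of_mem`).

The converse, and the fact that g is determined by the element, come from an action of `IG` on
states that carry a group element, a column, the present copy, the number of changes of copy, and
whether the group element lay in H at the last change. The action respects basic products
(`act_act`): the matrix satisfies the singular square identities, and `K_H ∪ L_G` alters the group
element seen at a change only by a factor from H. The flag gives `emb_mul_eq_iff`, which reduces
membership in H to the word problem of `IG`.

Every element of `IG` is a generator from `K_H ∪ L_G`, an element of one copy, zero, or a mixed
product (`ig_cases`). Mixed products raise the number of changes, so they are not idempotent. Bands
have trivial H-classes, so a maximal subgroup stays within one class and is trivial or isomorphic to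
`G`.

A triangular presentation exists because one can take the values of all sufficiently short words as
generators, with all products that hold among them as relations. -/

/-! ### Triples of `L_G`, the sandwich matrix and the relations of a copy of `K_G` -/

/-- `LTriple R s t x` says that `lElt s t x` belongs to `L_G`. -/
def LTriple {A : Type v} (R : Set (A × A × A)) (s t x : AOne A) : Prop :=
  (s = none ∧ t = x) ∨ (s = t ∧ x = none) ∨
    ∃ a b c, (a, b, c) ∈ R ∧ s = some b ∧ t = some c ∧ x = some a

theorem lElt_mem_LG {A : Type v} {R : Set (A × A × A)} {s t x : AOne A} (h : LTriple R s t x) :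
    lElt s t x ∈ LG R := by
  rcases h with ⟨rfl, rfl⟩ | ⟨rfl, rfl⟩ | ⟨a, b, c, h, rfl, rfl, rfl⟩
  · exact Or.inl ⟨_, rfl⟩
  · exact Or.inr (Or.inl ⟨_, rfl⟩)
  · exact Or.inr (Or.inr ⟨a, b, c, h, rfl⟩)

theorem exists_lTriple {A : Type v} {R : Set (A × A × A)} {y : BiTrans A} (h : y ∈ LG R) :
    ∃ s t x, LTriple R s t x ∧ y = lElt s t x := by
  rcases h with ⟨a, rfl⟩ | ⟨a, rfl⟩ | ⟨a, b, c, h, rfl⟩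
  · exact ⟨_, _, _, Or.inl ⟨rfl, rfl⟩, rfl⟩
  · exact ⟨_, _, _, Or.inr (Or.inl ⟨rfl, rfl⟩), rfl⟩
  · exact ⟨_, _, _, Or.inr (Or.inr ⟨a, b, c, h, rfl, rfl, rfl⟩), rfl⟩

/-- The condition for a column to belong to `B₁`. -/
def InBOne {A : Type v} (B : Set A) (b : AOne A) : Prop := b = none ∨ ∃ b' ∈ B, b = some b'

/-- The action of `lElt s t x` on the rows. -/
def rowMap {A : Type v} (s t : AOne A) : RowIndex A → RowIndex A :=
  Sum.elim (fun _ => Sum.inl s) (fun _ => Sum.inr t)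

/-- The extension of `gen` to `A₁` with value `1` at the new symbol. -/
def genOne {A : Type v} {G : Type u} [Group G] (gen : A → G) : AOne A → G
  | none => 1
  | some a => gen a

/-- The sandwich matrix of the Rees matrix semigroup formed by a copy of `K_G`. -/
def sandwich {A : Type v} {G : Type u} [Group G] (gen : A → G) : ColIndex A → RowIndex A → G
  | some _, Sum.inl _ => 1
  | some a, Sum.inr _ => (genOne gen a)⁻¹
  | none, Sum.inl a => (genOne gen a)⁻¹
  | none, Sum.inr a => (genOne gen a)⁻¹

/-- Elements `m i j` of a semigroup, acted on by elements `l s t x` and `k a b`, that satisfy the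
relations of a copy of `K_G` acted on by `L_G` and `K_H` in the free idempotent generated
semigroup. -/
structure IsCopy {A : Type v} (R : Set (A × A × A)) (B : Set A) {Q : Type*} [Semigroup Q]
    (l : ∀ s t x, LTriple R s t x → Q) (k : AOne A → ∀ b, InBOne B b → Q)
    (m : RowIndex A → ColIndex A → Q) : Prop where
  row : ∀ i j j', m i j * m i j' = m i j'
  col : ∀ i i' j, m i j * m i' j = m i j
  l_m : ∀ s t x h i j, (j ≠ none ∨ i = Sum.inl s ∨ i = Sum.inr t) →
    l s t x h * m i j = m (rowMap s t i) j
  m_l : ∀ s t x h i j, (j ≠ none ∨ i = Sum.inl s ∨ i = Sum.inr t) →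
    m i j * l s t x h = m i (some (j.getD x))
  k_m_col : ∀ a b h i, k a b h * m i (some b) = m (Sum.inl a) (some b)
  k_m_row : ∀ a b h j, k a b h * m (Sum.inl a) j = m (Sum.inl a) j
  m_k_row : ∀ a b h j, m (Sum.inl a) j * k a b h = m (Sum.inl a) (some b)
  m_k_col : ∀ a b h i, m i (some b) * k a b h = m i (some b)

/-! ### The maximal subgroup at (1, 1) of a copy -/

namespace IsCopy

variable {A : Type v} {R : Set (A × A × A)} {B : Set A} {Q : Type*} [Semigroup Q]
  {l : ∀ s t x, LTriple R s t x → Q} {k : AOne A → ∀ b, InBOne B b → Q}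
  {m : RowIndex A → ColIndex A → Q}

/-- The element `lElt s t x` can be absorbed by either factor: on the left it turns column ∞ into x,
on the right it fixes the row `i'`. -/
theorem singular (hm : IsCopy R B l k m) {s t x : AOne A} (h : LTriple R s t x)
    {i i' : RowIndex A} (hi : i = Sum.inl s ∨ i = Sum.inr t)
    (hi' : i' = Sum.inl s ∨ i' = Sum.inr t) (j : ColIndex A) :
    m i (some x) * m i' j = m i none * m i' j := by
  have h1 : rowMap s t i' = i' := by rcases hi' with rfl | rfl <;> rfl
  have h2 := hm.m_l s t x h i none (Or.inr hi)
  have h3 := hm.l_m s t x h i' j (Or.inr hi')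
  rw [h1] at h3
  calc m i (some x) * m i' j = m i none * l s t x h * m i' j := by rw [h2]; rfl
    _ = _ := by rw [mul_assoc, h3]

/-- The element e_1 fixes column j and merges all rows of A₁, so passing it across the product makes
the row irrelevant. -/
theorem base_mul_inl (hm : IsCopy R B l k m) (i : RowIndex A) (j a : AOne A) :
    m i (some j) * m (Sum.inl a) (some none) = m i (some j) * m (Sum.inl none) (some none) := by
  have h : LTriple R none none none := Or.inl ⟨rfl, rfl⟩
  have h1 := hm.m_l _ _ _ h i (some j) (Or.inl (by simp))
  have h2 := hm.l_m _ _ _ h (Sum.inl a) (some none) (Or.inl (by simp))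
  calc _ = m i (some j) * l _ _ _ h * m (Sum.inl a) (some none) := by rw [h1]; rfl
    _ = _ := by rw [mul_assoc, h2]; rfl

theorem base_mul_inr (hm : IsCopy R B l k m) (i : RowIndex A) (j : AOne A) (a : AOne A)  :
    m i (some j) * m (Sum.inr a) (some none) = m i (some j) * m (Sum.inr none) (some none) := by
  have h : LTriple R none none none := Or.inl ⟨rfl, rfl⟩
  have h1 := hm.m_l _ _ _ h i (some j) (Or.inl (by simp))
  have h2 := hm.l_m _ _ _ h (Sum.inr a) (some none) (Or.inl (by simp))
  calc _ = m i (some j) * l _ _ _ h * m (Sum.inr a) (some none) := by rw [h1]; rfl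
    _ = _ := by rw [mul_assoc, h2]; rfl

theorem col_mul_inl (hm : IsCopy R B l k m) (j : AOne A) (a : AOne A) :
    m (Sum.inl none) (some j) * m (Sum.inl a) (some none) = m (Sum.inl none) (some none) := by
  rw [hm.base_mul_inl, hm.row]

theorem inl_mul_row (hm : IsCopy R B l k m) (j : AOne A) (a : AOne A) :
    m (Sum.inl a) (some none) * m (Sum.inl none) (some j) = m (Sum.inl a) (some j) := by
  have h : LTriple R a a none := Or.inr (Or.inl ⟨rfl, rfl⟩)
  have h1 := hm.l_m _ _ _ h (Sum.inl none) (some none) (Or.inl (by simp))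
  have h2 := hm.l_m _ _ _ h (Sum.inl none) (some j) (Or.inl (by simp))
  calc _ = l _ _ _ h * m (Sum.inl none) (some none) * m (Sum.inl none) (some j) := by rw [h1]; rfl
    _ = _ := by rw [mul_assoc, hm.row, h2]; rfl

/-- This normalises the sandwich entry at column 1 and row 1̄. The square of e_1 replaces column 1
by ∞, where `col` removes the row 1̄. -/
theorem one_mul_bar (hm : IsCopy R B l k m) :
    m (Sum.inl none) (some none) * m (Sum.inr none) (some none) =
      m (Sum.inl none) (some none) := by
  have h : LTriple R none none none := Or.inl ⟨rfl, rfl⟩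
  have h1 := hm.m_l _ _ _ h (Sum.inl none) none (Or.inr (Or.inl rfl))
  have h2 := hm.m_l _ _ _ h (Sum.inr none) none (Or.inr (Or.inr rfl))
  calc _ = m (Sum.inl none) none * m (Sum.inr none) (some none) :=
        hm.singular h (Or.inl rfl) (Or.inr rfl) _
    _ = m (Sum.inl none) none * (m (Sum.inr none) none * l _ _ _ h) := by rw [h2]; rfl
    _ = _ := by rw [← mul_assoc, hm.col, h1]; rfl

/-- The idempotent at the position `(1, 1)`. -/
def base (hm : IsCopy R B l k m) : Idempotents Q :=
  ⟨m (Sum.inl none) (some none), hm.row _ _ _⟩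

/-- The element of the maximal subgroup at `(1, 1)` that corresponds to a generator. -/
def genElt (m : RowIndex A → ColIndex A → Q) (a : AOne A) : Q :=
  m (Sum.inl none) (some none) * m (Sum.inr none) (some a) * m (Sum.inl none) (some none)

/-- The inverse of `genElt m a`. -/
def invElt (m : RowIndex A → ColIndex A → Q) (a : AOne A) : Q :=
  m (Sum.inl none) (some a) * m (Sum.inr none) (some none)

theorem invElt_mul_genElt (hm : IsCopy R B l k m) (a : AOne A) :
    invElt m a * genElt m a = m (Sum.inl none) (some none) := by
  unfold invElt genElt
  calc _ = m (Sum.inl none) (some a) * (m (Sum.inr none) (some none) *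
        m (Sum.inl none) (some none) * m (Sum.inr none) (some a)) *
          m (Sum.inl none) (some none) := by simp only [mul_assoc]
    _ = _ := by rw [hm.col, hm.row, hm.col, hm.row]

theorem genElt_mul_invElt (hm : IsCopy R B l k m) (a : AOne A) :
    genElt m a * invElt m a = m (Sum.inl none) (some none) := by
  unfold invElt genElt
  calc _ = m (Sum.inl none) (some none) * (m (Sum.inr none) (some a) *
        (m (Sum.inl none) (some none) * m (Sum.inl none) (some a))) *
          m (Sum.inr none) (some none) := by simp only [mul_assoc]
    _ = m (Sum.inl none) (some none) * (m (Sum.inr none) (some a) *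
          m (Sum.inr none) (some none)) := by rw [hm.row, hm.col, mul_assoc]
    _ = _ := by rw [hm.row, hm.one_mul_bar]

theorem greenH_genElt (hm : IsCopy R B l k m) (a : AOne A) : GreenH (genElt m a) hm.base := by
  refine (greenH_iff _ _).2 ⟨?_, ?_, invElt m a, ?_, ?_, hm.genElt_mul_invElt a,
    hm.invElt_mul_genElt a⟩
  · change m _ _ * (m _ _ * _ * _) = _
    rw [← mul_assoc, ← mul_assoc, hm.row]; rfl
  · change _ * m _ _ * m _ _ = _
    rw [mul_assoc, hm.row]; rfl
  · change m _ _ * (m _ _ * _) = _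
    rw [← mul_assoc, hm.row]; rfl
  · change _ * m _ _ * m _ _ = _
    rw [mul_assoc, hm.col]; rfl

/-- `genElt m a` as an element of the maximal subgroup. -/
def genMax (hm : IsCopy R B l k m) (a : AOne A) : MaximalSubgroup hm.base :=
  ⟨genElt m a, hm.greenH_genElt a⟩

theorem inv_genMax (hm : IsCopy R B l k m) (a : AOne A) : ((hm.genMax a)⁻¹).1 = invElt m a := by
  have h : GreenH (invElt m a) hm.base := by
    obtain ⟨h1, h2, -⟩ := (greenH_iff _ _).1 (hm.greenH_genElt a)
    refine (greenH_iff _ _).2 ⟨?_, ?_, genElt m a, h1, h2, hm.invElt_mul_genElt a,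
      hm.genElt_mul_invElt a⟩
    · change m _ _ * (m _ _ * _) = _
      rw [← mul_assoc, hm.row]; rfl
    · change _ * m _ _ * m _ _ = _
      rw [mul_assoc, hm.col]; rfl
  have : (hm.genMax a)⁻¹ = ⟨invElt m a, h⟩ :=
    inv_eq_of_mul_eq_one_right (Subtype.ext (hm.genElt_mul_invElt a))
  rw [this]

theorem genMax_none (hm : IsCopy R B l k m) : hm.genMax none = 1 := by
  rw [← inv_eq_one]
  exact Subtype.ext ((hm.inv_genMax none).trans hm.one_mul_bar)

/-- The square of e_a identifies column ∞ with column a in front of row ā; the square of e_ā then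
carries the value from row ā to row a in `infty_mul_inl`. -/
theorem infty_mul_inr (hm : IsCopy R B l k m) (a : AOne A) :
    m (Sum.inl none) none * m (Sum.inr a) (some none) = invElt m a := by
  have h : LTriple R none a a := Or.inl ⟨rfl, rfl⟩
  rw [← hm.singular h (Or.inl rfl) (Or.inr rfl), hm.base_mul_inr]; rfl

theorem infty_mul_inl (hm : IsCopy R B l k m) (a : AOne A) :
    m (Sum.inl none) none * m (Sum.inl a) (some none) = invElt m a := by
  have h : LTriple R a a none := Or.inr (Or.inl ⟨rfl, rfl⟩)
  have h1 := hm.singular h (Or.inr rfl) (Or.inl rfl) (some none)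
  rw [← hm.col (Sum.inl none) (Sum.inr a), mul_assoc, ← h1, hm.col, hm.infty_mul_inr]

/-- In front of row c̄, the square of e_r replaces (b, ∞) by (b, a). Splitting (b, a) as (b, 1)(1,
a) leaves the column ∞ entry at b followed by the column a entry at c̄. -/
theorem invElt_relation (hm : IsCopy R B l k m) {a b c : A} (h : (a, b, c) ∈ R) :
    invElt m (some c) = invElt m (some b) * invElt m (some a) := by
  have h' : LTriple R (some b) (some c) (some a) := Or.inr (Or.inr ⟨a, b, c, h, rfl, rfl, rfl⟩)
  have h1 := hm.singular h' (Or.inl rfl) (Or.inr rfl) (some none)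
  rw [← hm.infty_mul_inr, ← hm.col (Sum.inl none) (Sum.inl (some b)), mul_assoc, ← h1,
    ← hm.inl_mul_row (some a) (some b), mul_assoc, hm.base_mul_inr, ← mul_assoc,
    hm.infty_mul_inl]
  rfl

end IsCopy

/-! ### The homomorphism from `G` and Rees matrix coordinates -/

namespace IsCopy

variable {G : Type u} [Group G] {H : Subgroup G} {P : TriangularPresentation.{u, v} G H}
  {Q : Type*} [Semigroup Q] {l : ∀ s t x, LTriple P.R s t x → Q}
  {k : AOne P.A → ∀ b, InBOne P.B b → Q} {m : RowIndex P.A → ColIndex P.A → Q}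

theorem ker_le (hm : IsCopy P.R P.B l k m) :
    (FreeGroup.lift P.gen).ker ≤ (FreeGroup.lift fun a => hm.genMax (some a)).ker := by
  rw [P.ker_eq]
  refine Subgroup.normalClosure_le_normal ?_
  rintro _ ⟨a, b, c, h, rfl⟩
  rw [SetLike.mem_coe, MonoidHom.mem_ker]
  simp only [map_mul, map_inv, FreeGroup.lift_apply_of]
  rw [mul_inv_eq_one, ← inv_inj, mul_inv_rev]
  refine Subtype.ext ?_
  rw [inv_genMax, hm.invElt_relation h, ← inv_genMax, ← inv_genMax]
  rfl

/-- The canonical homomorphism from `G` to the maximal subgroup at `(1, 1)`. -/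
noncomputable def groupHom (hm : IsCopy P.R P.B l k m) : G →* MaximalSubgroup hm.base :=
  (FreeGroup.lift P.gen).liftOfSurjective P.gen_surjective
    ⟨FreeGroup.lift fun a => hm.genMax (some a), hm.ker_le⟩

theorem groupHom_gen (hm : IsCopy P.R P.B l k m) (a : P.A) :
    hm.groupHom (P.gen a) = hm.genMax (some a) := by
  have := (FreeGroup.lift P.gen).liftOfRightInverse_comp_apply _
    (Function.rightInverse_surjInv P.gen_surjective)
    ⟨FreeGroup.lift fun a => hm.genMax (some a), hm.ker_le⟩ (FreeGroup.of a)
  rw [FreeGroup.lift_apply_of] at this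
  exact this.trans FreeGroup.lift_apply_of

theorem groupHom_genOne (hm : IsCopy P.R P.B l k m) (a : AOne P.A) :
    hm.groupHom (genOne P.gen a) = hm.genMax a := by
  cases a with
  | none => rw [genMax_none]; exact map_one _
  | some a => exact hm.groupHom_gen a

/-- The composition of `groupHom` with the inclusion. -/
noncomputable def emb (hm : IsCopy P.R P.B l k m) (g : G) : Q := (hm.groupHom g).1

theorem emb_mul (hm : IsCopy P.R P.B l k m) (g g' : G) :
    hm.emb (g * g') = hm.emb g * hm.emb g' := by
  unfold emb
  rw [map_mul]; rfl

theorem emb_one (hm : IsCopy P.R P.B l k m) :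
    hm.emb 1 = m (Sum.inl none) (some none) := by
  unfold emb
  rw [map_one]; rfl

theorem emb_genOne (hm : IsCopy P.R P.B l k m) (a : AOne P.A) :
    hm.emb (genOne P.gen a) = genElt m a := by
  unfold emb
  rw [groupHom_genOne]; rfl

theorem emb_genOne_inv (hm : IsCopy P.R P.B l k m) (a : AOne P.A) :
    hm.emb (genOne P.gen a)⁻¹ = invElt m a := by
  unfold emb
  rw [map_inv, groupHom_genOne, inv_genMax]

theorem emb_mul_base (hm : IsCopy P.R P.B l k m) (g : G) :
    hm.emb g * m (Sum.inl none) (some none) = hm.emb g := by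
  rw [← hm.emb_one, ← emb_mul, mul_one]

theorem base_mul_emb (hm : IsCopy P.R P.B l k m) (g : G) :
    m (Sum.inl none) (some none) * hm.emb g = hm.emb g := by
  rw [← hm.emb_one, ← emb_mul, one_mul]

/-- These products are the sandwich entries, so coordinates multiply as in a Rees matrix semigroup.
-/
theorem row_mul_col (hm : IsCopy P.R P.B l k m) (i : RowIndex P.A) (j : ColIndex P.A) :
    m (Sum.inl none) j * m i (some none) = hm.emb (sandwich P.gen j i) := by
  rcases j with _ | j <;> rcases i with a | a
  · rw [hm.infty_mul_inl, ← emb_genOne_inv]; rfl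
  · rw [hm.infty_mul_inr, ← emb_genOne_inv]; rfl
  · rw [hm.col_mul_inl, ← hm.emb_one]; rfl
  · rw [hm.base_mul_inr, ← invElt, ← emb_genOne_inv]; rfl

/-- The element of the completely simple semigroup generated by a copy of `K_G` with the
Rees matrix coordinates `(i, g, j)`. -/
noncomputable def coord (hm : IsCopy P.R P.B l k m) (i : RowIndex P.A) (g : G) (j : ColIndex P.A) : Q :=
  m i (some none) * hm.emb g * m (Sum.inl none) j

theorem coord_mul_coord (hm : IsCopy P.R P.B l k m) (i i' : RowIndex P.A) (g g' : G)
    (j j' : ColIndex P.A) :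
    hm.coord i g j * hm.coord i' g' j' = hm.coord i (g * sandwich P.gen j i' * g') j' := by
  unfold coord
  rw [emb_mul, emb_mul, ← row_mul_col]
  simp only [mul_assoc]

/-- An idempotent has as group coordinate the inverse of its sandwich entry; `h2` shows that the
part of `m i j` cut out at (1, 1) is that inverse. -/
theorem eq_coord (hm : IsCopy P.R P.B l k m) (i : RowIndex P.A) (j : ColIndex P.A) :
    m i j = hm.coord i (sandwich P.gen j i)⁻¹ j := by
  have h1 : m i (some none) * (m (Sum.inl none) (some none) * m i j *
      m (Sum.inl none) (some none)) * m (Sum.inl none) j = m i j := by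
    calc _ = (m i (some none) * m (Sum.inl none) (some none)) * m i j *
          (m (Sum.inl none) (some none) * m (Sum.inl none) j) := by simp only [mul_assoc]
      _ = _ := by rw [hm.col, hm.row, hm.row, hm.col]
  have h2 : hm.emb (sandwich P.gen j i) * (m (Sum.inl none) (some none) * m i j *
      m (Sum.inl none) (some none)) = m (Sum.inl none) (some none) := by
    calc _ = hm.emb (sandwich P.gen j i) * m (Sum.inl none) (some none) * m i j *
          m (Sum.inl none) (some none) := by simp only [mul_assoc]
      _ = _ := by
        rw [emb_mul_base, ← row_mul_col, mul_assoc (m _ j), hm.row, hm.col, hm.row]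
  have h3 : m (Sum.inl none) (some none) * m i j * m (Sum.inl none) (some none) =
      hm.emb (sandwich P.gen j i)⁻¹ := by
    have := congrArg (hm.emb (sandwich P.gen j i)⁻¹ * ·) h2
    simp only [emb_mul_base] at this
    rw [← this, ← mul_assoc, ← emb_mul, inv_mul_cancel, emb_one, ← mul_assoc, ← mul_assoc, hm.row]
  rw [coord, ← h3, h1]

theorem emb_eq_coord (hm : IsCopy P.R P.B l k m) (g : G) :
    hm.emb g = hm.coord (Sum.inl none) g (some none) := by
  rw [coord, base_mul_emb, emb_mul_base]

/-- The completely simple semigroup generated by a copy of `K_G`. -/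
noncomputable def coords (hm : IsCopy P.R P.B l k m) : Set Q := {x | ∃ i g j, x = hm.coord i g j}

theorem m_mem_coords (hm : IsCopy P.R P.B l k m) (i : RowIndex P.A) (j : ColIndex P.A) :
    m i j ∈ hm.coords := ⟨_, _, _, hm.eq_coord i j⟩

theorem mul_mem_coords (hm : IsCopy P.R P.B l k m) {x y : Q} (hx : x ∈ hm.coords)
    (hy : y ∈ hm.coords) : x * y ∈ hm.coords := by
  obtain ⟨i, g, j, rfl⟩ := hx
  obtain ⟨i', g', j', rfl⟩ := hy
  exact ⟨_, _, _, hm.coord_mul_coord _ _ _ _ _ _⟩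

theorem emb_mem_coords (hm : IsCopy P.R P.B l k m) (g : G) : hm.emb g ∈ hm.coords :=
  ⟨_, _, _, hm.emb_eq_coord g⟩

theorem coord_eq_mul (hm : IsCopy P.R P.B l k m) (i : RowIndex P.A) (g : G) (j : ColIndex P.A) :
    ∃ y ∈ hm.coords, hm.coord i g j = y * m (Sum.inl none) j :=
  ⟨_, hm.mul_mem_coords (hm.m_mem_coords _ _) (hm.emb_mem_coords g), rfl⟩

theorem coord_eq_mul' (hm : IsCopy P.R P.B l k m) (i : RowIndex P.A) (g : G) (j : ColIndex P.A) :
    ∃ y ∈ hm.coords, hm.coord i g j = m i (some none) * y :=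
  ⟨_, hm.mul_mem_coords (hm.emb_mem_coords g) (hm.m_mem_coords _ _), mul_assoc _ _ _⟩

theorem mul_l_mem_coords (hm : IsCopy P.R P.B l k m) {x : Q} (hx : x ∈ hm.coords)
    {s t y : AOne P.A} (h : LTriple P.R s t y) : x * l s t y h ∈ hm.coords := by
  obtain ⟨i, g, j, rfl⟩ := hx
  obtain ⟨z, hz, e⟩ := hm.coord_eq_mul i g j
  -- If the column is ∞, the product with `l` is known only in the rows s and t̄, so a factor in row
  -- s is inserted.
  rw [e, ← hm.col _ (Sum.inl s), mul_assoc, mul_assoc, hm.m_l _ _ _ _ _ _ (Or.inr (Or.inl rfl))]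
  exact hm.mul_mem_coords hz (hm.mul_mem_coords (hm.m_mem_coords _ _) (hm.m_mem_coords _ _))

theorem l_mul_mem_coords (hm : IsCopy P.R P.B l k m) {x : Q} (hx : x ∈ hm.coords)
    {s t y : AOne P.A} (h : LTriple P.R s t y) : l s t y h * x ∈ hm.coords := by
  obtain ⟨i, g, j, rfl⟩ := hx
  obtain ⟨z, hz, e⟩ := hm.coord_eq_mul' i g j
  rw [e, ← mul_assoc, hm.l_m _ _ _ _ _ _ (Or.inl (by simp))]
  exact hm.mul_mem_coords (hm.m_mem_coords _ _) hz

theorem mul_k_mem_coords (hm : IsCopy P.R P.B l k m) {x : Q} (hx : x ∈ hm.coords)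
    {a b : AOne P.A} (h : InBOne P.B b) : x * k a b h ∈ hm.coords := by
  obtain ⟨i, g, j, rfl⟩ := hx
  obtain ⟨z, hz, e⟩ := hm.coord_eq_mul i g j
  rw [e, ← hm.col _ (Sum.inl a), mul_assoc, mul_assoc, hm.m_k_row]
  exact hm.mul_mem_coords hz (hm.mul_mem_coords (hm.m_mem_coords _ _) (hm.m_mem_coords _ _))

theorem k_mul_mem_coords (hm : IsCopy P.R P.B l k m) {x : Q} (hx : x ∈ hm.coords)
    {a b : AOne P.A} (h : InBOne P.B b) : k a b h * x ∈ hm.coords := by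
  obtain ⟨i, g, j, rfl⟩ := hx
  obtain ⟨z, hz, e⟩ := hm.coord_eq_mul' i g j
  -- A left factor `k a b` can move the row only in column b, so a factor in that column is
  -- inserted.
  rw [e, ← hm.row _ (some b), ← mul_assoc, ← mul_assoc, hm.k_m_col]
  exact hm.mul_mem_coords (hm.mul_mem_coords (hm.m_mem_coords _ _) (hm.m_mem_coords _ _)) hz

/-- In a product of two copies, the elements of `H` can be moved from one copy to the other. -/
theorem emb_mul_base_of_mem {m' : RowIndex P.A → ColIndex P.A → Q}
    (hm : IsCopy P.R P.B l k m) (hm' : IsCopy P.R P.B l k m') {g : G} (hg : g ∈ H) :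
    hm.emb g * m' (Sum.inl none) (some none) = m (Sum.inl none) (some none) * hm'.emb g := by
  let K : Subgroup G :=
    { carrier := {g | hm.emb g * hm'.emb 1 = hm.emb 1 * hm'.emb g}
      one_mem' := rfl
      mul_mem' := by
        intro a b ha hb
        calc hm.emb (a * b) * hm'.emb 1 = hm.emb a * (hm.emb b * hm'.emb 1) := by
              rw [emb_mul, mul_assoc]
          _ = hm.emb (a * 1) * hm'.emb (1 * b) := by rw [hb, emb_mul, one_mul, mul_assoc]
          _ = hm.emb a * hm'.emb 1 * hm'.emb b := by rw [emb_mul hm', mul_one, mul_assoc]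
          _ = hm.emb 1 * hm'.emb (a * b) := by rw [ha, emb_mul, mul_assoc]
      inv_mem' := by
        intro a ha
        calc hm.emb a⁻¹ * hm'.emb 1 = hm.emb a⁻¹ * hm'.emb (a * a⁻¹) := by rw [mul_inv_cancel]
          _ = hm.emb (a⁻¹ * 1) * hm'.emb a * hm'.emb a⁻¹ := by rw [emb_mul, mul_one, mul_assoc]
          _ = hm.emb a⁻¹ * (hm.emb 1 * hm'.emb a) * hm'.emb a⁻¹ := by
              rw [emb_mul]; simp only [mul_assoc]
          _ = hm.emb (a⁻¹ * a) * hm'.emb (1 * a⁻¹) := by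
              rw [← ha, emb_mul, emb_mul]; simp only [mul_assoc]
          _ = _ := by rw [inv_mul_cancel, one_mul] }
  suffices H ≤ K by
    rw [← hm.emb_one, ← hm'.emb_one]
    exact this hg
  rw [← P.closure_B, Subgroup.closure_le]
  rintro _ ⟨b, hb, rfl⟩
  -- The inverse of a generator has the simpler expression `invElt`.
  rw [SetLike.mem_coe, ← inv_mem_iff]
  change hm.emb (genOne P.gen (some b))⁻¹ * hm'.emb 1 =
    hm.emb 1 * hm'.emb (genOne P.gen (some b))⁻¹
  rw [emb_genOne_inv, emb_genOne_inv, emb_one, emb_one]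
  have h₁ : LTriple P.R none (some b) (some b) := Or.inl ⟨rfl, rfl⟩
  have h₂ : LTriple P.R (some b) (some b) none := Or.inr (Or.inl ⟨rfl, rfl⟩)
  have hB : InBOne P.B (some b) := Or.inr ⟨b, hb, rfl⟩
  have hB' : InBOne P.B none := Or.inl rfl
  -- The element (1, 1) of `K_H` is split off the right factor and resets the column of the left
  -- one.
  have e₁ : ∀ i, m (Sum.inl none) (some i) * m' (Sum.inl none) (some none) =
      m (Sum.inl none) (some none) * m' (Sum.inl none) (some none) := fun i => by
    rw [← hm'.k_m_row none none hB', ← mul_assoc, ← mul_assoc, hm.m_k_row, hm.m_k_row]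
  -- Route through e_b: it turns ∞ into b on the left and fixes b̄ on the right. Then (1, b), which
  -- lies in `K_H` because b is in B, inserts a factor of the second copy.
  have e₂ : m (Sum.inl none) none * m' (Sum.inr (some b)) (some none) =
      m (Sum.inl none) (some none) * invElt m' (some b) := by
    have a₁ := hm.m_l _ _ _ h₁ (Sum.inl none) none (Or.inr (Or.inl rfl))
    have a₂ := hm'.l_m _ _ _ h₁ (Sum.inr (some b)) (some none) (Or.inl (by simp))
    have a₃ := hm.m_k_row none (some b) hB (some (some b))
    calc _ = m (Sum.inl none) none * (l _ _ _ h₁ * m' (Sum.inr (some b)) (some none)) := by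
          rw [a₂]; rfl
      _ = m (Sum.inl none) (some (some b)) * m' (Sum.inr (some b)) (some none) := by
          rw [← mul_assoc, a₁]; rfl
      _ = m (Sum.inl none) (some (some b)) * (k none (some b) hB *
            m' (Sum.inr (some b)) (some (some b))) * m' (Sum.inr (some b)) (some none) := by
          rw [← mul_assoc, a₃, mul_assoc, hm'.row]
      _ = m (Sum.inl none) (some (some b)) * m' (Sum.inl none) (some none) *
            invElt m' (some b) := by
          rw [hm'.k_m_col, mul_assoc, hm'.base_mul_inr, ← invElt, mul_assoc, invElt, ← mul_assoc
            (m' _ (some none)), hm'.row]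
      _ = _ := by rw [e₁, mul_assoc, invElt, ← mul_assoc (m' _ _), hm'.row]
  -- Route through e_b̄: with row b̄ inserted, it turns ∞ into 1, so `invElt` arises in the first
  -- copy; (1, 1) of `K_H` then moves row b̄ of the second copy to row 1.
  have e₃ : m (Sum.inl none) none * m' (Sum.inr (some b)) (some none) =
      invElt m (some b) * m' (Sum.inl none) (some none) := by
    have a₁ := hm.m_l _ _ _ h₂ (Sum.inr (some b)) none (Or.inr (Or.inr rfl))
    have a₂ := hm'.l_m _ _ _ h₂ (Sum.inr (some b)) (some none) (Or.inl (by simp))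
    calc _ = m (Sum.inl none) none * (m (Sum.inr (some b)) none *
          (l _ _ _ h₂ * m' (Sum.inr (some b)) (some none))) := by
          rw [a₂, ← mul_assoc, hm.col]; rfl
      _ = m (Sum.inl none) none * m (Sum.inr (some b)) (some none) *
            m' (Sum.inr (some b)) (some none) := by
          rw [← mul_assoc (m _ _) (l _ _ _ _), a₁, mul_assoc]; rfl
      _ = invElt m (some b) * (k none none hB' * m' (Sum.inr (some b)) (some none)) := by
          rw [hm.infty_mul_inr, ← mul_assoc, invElt, mul_assoc _ _ (k _ _ _), hm.m_k_col]
      _ = _ := by rw [hm'.k_m_col]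
  rw [← e₂, e₃]

end IsCopy

/-! ### The universal property of `IG` -/

section IGBasics

variable {S : Type u} [Semigroup S]

/-- The generator of `IG S` given by an idempotent of `S`. -/
def igOf (e : Idempotents S) : IG S := ((FreeSemigroup.of e : FreeSemigroup _) : (conGen (IGRel S)).Quotient)

theorem igOf_mul (e f g : Idempotents S) (hb : IsBasicPair (e : S) (f : S))
    (hg : (e : S) * (f : S) = (g : S)) : igOf e * igOf f = igOf g :=
  (Con.eq _).2 (ConGen.Rel.of _ _ (IGRel.basic e f g hb hg))

/-- The homomorphism from `IG S` induced by a map on idempotents that respects the products of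
basic pairs. -/
def igLift {T : Type*} [Semigroup T] (φ : Idempotents S → T)
    (h : ∀ e f g : Idempotents S, IsBasicPair (e : S) (f : S) → (e : S) * (f : S) = (g : S) →
      φ e * φ f = φ g) : IG S →ₙ* T where
  toFun x := Con.liftOn (c := conGen (IGRel S)) x (FreeSemigroup.lift φ) fun a b hab => by
    have : conGen (IGRel S) ≤ Con.ker (FreeSemigroup.lift φ) := by
      refine Con.conGen_le.2 ?_
      rintro _ _ ⟨e, f, g, hb, hg⟩
      exact h e f g hb hg
    exact this hab
  map_mul' x y := by
    refine Con.induction_on₂ (c := conGen (IGRel S)) x y fun a b => ?_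
    exact map_mul (FreeSemigroup.lift φ) a b

theorem ig_induction {p : IG S → Prop} (h1 : ∀ e, p (igOf e))
    (h2 : ∀ e x, p x → p (igOf e * x)) (x : IG S) : p x := by
  refine Con.induction_on (c := conGen (IGRel S)) x fun w => ?_
  induction w using FreeSemigroup.recOnMul with
  | ih1 e => exact h1 e
  | ih2 e y _ hy => exact h2 e _ hy

/-- The natural homomorphism from `IG S` to `S`. -/
def igProj : IG S →ₙ* S := igLift (fun e => (e : S)) fun _ _ _ _ h => h

end IGBasics

/-- The form used here of the fact that bands have trivial H-classes: x = xe = xxy = xy = e. -/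
theorem eq_of_mul_eq_of_band {S : Type*} [Semigroup S] (hS : ∀ x : S, x * x = x) {x y e : S}
    (h1 : x * e = x) (h2 : x * y = e) : x = e := by
  rw [← h1, ← h2, ← mul_assoc, hS]

/-! ### The elements of the band and its two copies of `K_G` -/

namespace TriangularPresentation

variable {G : Type u} [Group G] {H : Subgroup G} (P : TriangularPresentation.{u, v} G H)

theorem band_BG (y : BG P.R) : y * y = y := by
  obtain ⟨y, ⟨i, j, rfl⟩ | hy⟩ := y
  · rfl
  · obtain ⟨s, t, x, rfl⟩ := exists_lElt hy
    exact Subtype.ext (lElt_mul_lElt _ _ _ _ _ _)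

theorem band_mul_self (x : P.Band) : x * x = x := by
  obtain ⟨x, hx⟩ := x
  refine Subtype.ext ?_
  cases x with
  | base y => exact congrArg WSem.base (P.band_BG y)
  | prime y => exact congrArg WSem.prime (P.band_BG y)
  | dprime y => exact congrArg WSem.dprime (P.band_BG y)
  | zero => rfl

theorem finite_band : Finite P.Band := by
  have := P.finite_A
  have h1 : Finite (RowIndex P.A → RowIndex P.A) := inferInstance
  have h2 : Finite (Function.End (ColIndex P.A))ᵐᵒᵖ :=
    Finite.of_equiv (ColIndex P.A → ColIndex P.A) MulOpposite.opEquiv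
  have h3 : Finite (BiTrans P.A) := @Finite.instProd _ _ h1 h2
  have h4 : Finite (BG P.R) := Subtype.finite
  have : Finite (WSem (BG P.R)) := by
    refine Finite.of_surjective (α := Option (BG P.R ⊕ BG P.R ⊕ BG P.R)) (fun o => match o with
      | none => WSem.zero
      | some (Sum.inl s) => WSem.base s
      | some (Sum.inr (Sum.inl s)) => WSem.prime s
      | some (Sum.inr (Sum.inr s)) => WSem.dprime s) ?_
    rintro (s | s | s | _)
    · exact ⟨some (Sum.inl s), rfl⟩
    · exact ⟨some (Sum.inr (Sum.inl s)), rfl⟩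
    · exact ⟨some (Sum.inr (Sum.inr s)), rfl⟩
    · exact ⟨none, rfl⟩
  exact Subtype.finite

/-- The element of `K_G` with coordinates `(i, j)`. -/
def kG (i : RowIndex P.A) (j : ColIndex P.A) : BG P.R := ⟨kElt i j, Or.inl ⟨i, j, rfl⟩⟩

/-- The element `lElt s t x` of `L_G`. -/
def lG (s t x : AOne P.A) (h : LTriple P.R s t x) : BG P.R :=
  ⟨lElt s t x, Or.inr (lElt_mem_LG h)⟩

/-- The generator of the free idempotent generated semigroup given by an element of the band. -/
def ig (x : P.Band) : IG P.Band := igOf ⟨x, P.band_mul_self x⟩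

theorem ig_mul (x y : P.Band) (h : x * y = x ∨ x * y = y ∨ y * x = x ∨ y * x = y) :
    P.ig x * P.ig y = P.ig (x * y) := by
  refine igOf_mul _ _ _ ?_ rfl
  rcases h with h | h | h | h
  · exact ⟨x, Or.inl rfl, Or.inl h.symm⟩
  · exact ⟨y, Or.inr rfl, Or.inl h.symm⟩
  · exact ⟨x, Or.inl rfl, Or.inr h.symm⟩
  · exact ⟨y, Or.inr rfl, Or.inr h.symm⟩

theorem ig_mul_eq (x y z : P.Band) (h : x * y = x ∨ x * y = y ∨ y * x = x ∨ y * x = y)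
    (hz : x * y = z) : P.ig x * P.ig y = P.ig z := by rw [P.ig_mul x y h, hz]

/-- The element of `L_G ⊆ B_{G,H}`. -/
def bandL (s t x : AOne P.A) (h : LTriple P.R s t x) : P.Band :=
  ⟨WSem.base (P.lG s t x h), Or.inl (Or.inl (Or.inl ⟨_, Or.inr (lElt_mem_LG h), rfl⟩))⟩

/-- The element of `K_H ⊆ B_{G,H}`. -/
def bandK (a b : AOne P.A) (h : InBOne P.B b) : P.Band :=
  ⟨WSem.base (P.kG (Sum.inl a) (some b)),
    Or.inl (Or.inl (Or.inl ⟨_, Or.inl ⟨a, b, h, rfl⟩, rfl⟩))⟩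

/-- The element of `K_G' ⊆ B_{G,H}`. -/
def bandP (i : RowIndex P.A) (j : ColIndex P.A) : P.Band :=
  ⟨WSem.prime (P.kG i j), Or.inl (Or.inl (Or.inr ⟨_, ⟨i, j, rfl⟩, rfl⟩))⟩

/-- The element of `K_G'' ⊆ B_{G,H}`. -/
def bandD (i : RowIndex P.A) (j : ColIndex P.A) : P.Band :=
  ⟨WSem.dprime (P.kG i j), Or.inl (Or.inr ⟨_, ⟨i, j, rfl⟩, rfl⟩)⟩

/-- The zero of `B_{G,H}`. -/
def bandZ : P.Band := ⟨WSem.zero, Or.inr rfl⟩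

theorem band_cases (x : P.Band) : (∃ s t y h, x = P.bandL s t y h) ∨
    (∃ a b h, x = P.bandK a b h) ∨ (∃ i j, x = P.bandP i j) ∨ (∃ i j, x = P.bandD i j) ∨
      x = P.bandZ := by
  obtain ⟨x, ((⟨⟨y, _⟩, hy, rfl⟩ | ⟨⟨y, _⟩, hy, rfl⟩) | ⟨⟨y, _⟩, hy, rfl⟩) | rfl⟩ := x
  · rcases hy with ⟨a, b, hb, h⟩ | hy
    · obtain rfl : y = kElt (Sum.inl a) (some b) := h
      exact Or.inr (Or.inl ⟨a, b, hb, rfl⟩)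
    · obtain ⟨s, t, x, h, h'⟩ := exists_lTriple hy
      obtain rfl : y = lElt s t x := h'
      exact Or.inl ⟨s, t, x, h, rfl⟩
  · obtain ⟨i, j, h⟩ := hy
    obtain rfl : y = kElt i j := h
    exact Or.inr (Or.inr (Or.inl ⟨i, j, rfl⟩))
  · obtain ⟨i, j, h⟩ := hy
    obtain rfl : y = kElt i j := h
    exact Or.inr (Or.inr (Or.inr (Or.inl ⟨i, j, rfl⟩)))
  · exact Or.inr (Or.inr (Or.inr (Or.inr rfl)))

theorem isCopy_prime : IsCopy P.R P.B (fun s t x h => P.ig (P.bandL s t x h))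
    (fun a b h => P.ig (P.bandK a b h)) (fun i j => P.ig (P.bandP i j)) where
  row i j j' := P.ig_mul_eq _ _ _ (Or.inr (Or.inl rfl)) rfl
  col i i' j := P.ig_mul_eq _ _ _ (Or.inl rfl) rfl
  l_m s t x h i j hb := by
    refine P.ig_mul_eq _ _ _ ?_ rfl
    rcases hb with hb | rfl | rfl
    · obtain ⟨j, rfl⟩ := Option.ne_none_iff_exists'.1 hb
      exact Or.inr (Or.inr (Or.inr rfl))
    · exact Or.inr (Or.inl rfl)
    · exact Or.inr (Or.inl rfl)
  m_l s t x h i j hb := by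
    refine P.ig_mul_eq _ _ _ ?_ rfl
    rcases hb with hb | rfl | rfl
    · obtain ⟨j, rfl⟩ := Option.ne_none_iff_exists'.1 hb
      exact Or.inl rfl
    · exact Or.inr (Or.inr (Or.inl rfl))
    · exact Or.inr (Or.inr (Or.inl rfl))
  k_m_col a b h i := P.ig_mul_eq _ _ _ (Or.inr (Or.inr (Or.inr rfl))) rfl
  k_m_row a b h j := P.ig_mul_eq _ _ _ (Or.inr (Or.inl rfl)) rfl
  m_k_row a b h j := P.ig_mul_eq _ _ _ (Or.inr (Or.inr (Or.inl rfl))) rfl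
  m_k_col a b h i := P.ig_mul_eq _ _ _ (Or.inl rfl) rfl

theorem isCopy_dprime : IsCopy P.R P.B (fun s t x h => P.ig (P.bandL s t x h))
    (fun a b h => P.ig (P.bandK a b h)) (fun i j => P.ig (P.bandD i j)) where
  row i j j' := P.ig_mul_eq _ _ _ (Or.inr (Or.inl rfl)) rfl
  col i i' j := P.ig_mul_eq _ _ _ (Or.inl rfl) rfl
  l_m s t x h i j hb := by
    refine P.ig_mul_eq _ _ _ ?_ rfl
    rcases hb with hb | rfl | rfl
    · obtain ⟨j, rfl⟩ := Option.ne_none_iff_exists'.1 hb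
      exact Or.inr (Or.inr (Or.inr rfl))
    · exact Or.inr (Or.inl rfl)
    · exact Or.inr (Or.inl rfl)
  m_l s t x h i j hb := by
    refine P.ig_mul_eq _ _ _ ?_ rfl
    rcases hb with hb | rfl | rfl
    · obtain ⟨j, rfl⟩ := Option.ne_none_iff_exists'.1 hb
      exact Or.inl rfl
    · exact Or.inr (Or.inr (Or.inl rfl))
    · exact Or.inr (Or.inr (Or.inl rfl))
  k_m_col a b h i := P.ig_mul_eq _ _ _ (Or.inr (Or.inr (Or.inr rfl))) rfl
  k_m_row a b h j := P.ig_mul_eq _ _ _ (Or.inr (Or.inl rfl)) rfl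
  m_k_row a b h j := P.ig_mul_eq _ _ _ (Or.inr (Or.inr (Or.inl rfl))) rfl
  m_k_col a b h i := P.ig_mul_eq _ _ _ (Or.inl rfl) rfl

theorem ig_bandZ_mul (x : IG P.Band) : P.ig P.bandZ * x = P.ig P.bandZ := by
  have h : ∀ y : P.Band, P.ig P.bandZ * P.ig y = P.ig P.bandZ := fun y => by
    refine P.ig_mul_eq _ _ _ (Or.inl ?_) ?_ <;> rfl
  induction x using ig_induction with
  | h1 e => exact h e.1
  | h2 e x hx =>
    rw [← mul_assoc]
    change P.ig _ * P.ig e.1 * x = _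
    rw [h, hx]

theorem ig_mul_bandZ (y : P.Band) : P.ig y * P.ig P.bandZ = P.ig P.bandZ := by
  refine P.ig_mul_eq _ _ _ (Or.inr (Or.inl ?_)) ?_ <;>
  · rcases P.band_cases y with ⟨_, _, _, _, rfl⟩ | ⟨_, _, _, rfl⟩ | ⟨_, _, rfl⟩ | ⟨_, _, rfl⟩ | rfl <;>
    rfl

end TriangularPresentation

/-! ### The action on states -/

namespace TriangularPresentation

variable {G : Type u} [Group G] {H : Subgroup G} (P : TriangularPresentation.{u, v} G H)

/-- The left action of `B_G` on the rows. -/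
def row (y : BG P.R) : RowIndex P.A → RowIndex P.A := y.1.1

/-- The right action of `B_G` on the columns. -/
def col (y : BG P.R) : ColIndex P.A → ColIndex P.A := y.1.2.unop

theorem BG_cases (y : BG P.R) : (∃ i j, y = P.kG i j) ∨ ∃ s t x h, y = P.lG s t x h := by
  obtain ⟨y, ⟨i, j, rfl⟩ | hy⟩ := y
  · exact Or.inl ⟨i, j, rfl⟩
  · obtain ⟨s, t, x, h, rfl⟩ := exists_lTriple hy
    exact Or.inr ⟨s, t, x, h, rfl⟩

theorem gen_mul_gen {a b c : P.A} (h : (a, b, c) ∈ P.R) : P.gen a * P.gen b = P.gen c := by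
  have : FreeGroup.of a * FreeGroup.of b * (FreeGroup.of c)⁻¹ ∈ (FreeGroup.lift P.gen).ker := by
    rw [P.ker_eq]
    exact Subgroup.subset_normalClosure ⟨a, b, c, h, rfl⟩
  rw [MonoidHom.mem_ker] at this
  simpa [mul_inv_eq_one] using this

theorem genOne_mul_genOne {s t x : AOne P.A} (h : LTriple P.R s t x) :
    genOne P.gen x * genOne P.gen s = genOne P.gen t := by
  rcases h with ⟨rfl, rfl⟩ | ⟨rfl, rfl⟩ | ⟨a, b, c, h, rfl, rfl, rfl⟩
  · exact mul_one _
  · exact one_mul _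
  · exact P.gen_mul_gen h

/-- Only column ∞ under an element of `L_G` matters: row s gives s⁻¹ and row t̄ gives t⁻¹x, which
agree since xs = t in `G`. It makes `twist` independent of the row used to define it. -/
theorem sandwich_leftRight (y : BG P.R) (j : ColIndex P.A) (z z' : RowIndex P.A) :
    sandwich P.gen j (P.row y z) * (sandwich P.gen (P.col y j) (P.row y z))⁻¹ =
      sandwich P.gen j (P.row y z') * (sandwich P.gen (P.col y j) (P.row y z'))⁻¹ := by
  rcases P.BG_cases y with ⟨i, l, rfl⟩ | ⟨s, t, x, h, rfl⟩
  · rfl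
  · rcases j with _ | j
    · have h' := P.genOne_mul_genOne h
      suffices h₀ : ∀ z, sandwich P.gen none (rowMap s t z) *
          (sandwich P.gen (some x) (rowMap s t z))⁻¹ = (genOne P.gen s)⁻¹ from
        (h₀ z).trans (h₀ z').symm
      rintro (a | a)
      · change (genOne P.gen s)⁻¹ * 1⁻¹ = _
        simp
      · change (genOne P.gen t)⁻¹ * (genOne P.gen x)⁻¹⁻¹ = _
        rw [← h']
        group
    · exact (mul_inv_cancel _).trans (mul_inv_cancel _).symm

theorem sandwich_some (j : AOne P.A) (s t : AOne P.A) (w : RowIndex P.A) :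
    sandwich P.gen (some j) (rowMap s t w) = sandwich P.gen (some j) w := by
  rcases w with a | a <;> rfl

/-- An element of `K_G` has only one column in its image. An element of `L_G` has its columns in A₁,
whose entries depend only on whether the row is barred, and this is preserved. -/
theorem sandwich_upDown (y : BG P.R) (j j' : ColIndex P.A) (w : RowIndex P.A) :
    sandwich P.gen (P.col y j) (P.row y w) * (sandwich P.gen (P.col y j') (P.row y w))⁻¹ =
      sandwich P.gen (P.col y j) w * (sandwich P.gen (P.col y j') w)⁻¹ := by
  rcases P.BG_cases y with ⟨i, l, rfl⟩ | ⟨s, t, x, h, rfl⟩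
  · exact (mul_inv_cancel _).trans (mul_inv_cancel _).symm
  · change sandwich P.gen (some _) (rowMap s t w) * (sandwich P.gen (some _) (rowMap s t w))⁻¹ = _
    rw [sandwich_some, sandwich_some]; rfl

theorem sandwich_mem (j : AOne P.A) (hj : InBOne P.B j) (w : RowIndex P.A) :
    sandwich P.gen (some j) w ∈ H := by
  rcases w with a | a
  · exact H.one_mem
  · refine H.inv_mem ?_
    rcases hj with rfl | ⟨b, hb, rfl⟩
    · exact H.one_mem
    · exact P.closure_B.le (Subgroup.subset_closure ⟨b, hb, rfl⟩)

/-- This is where H enters: columns of `K_H` lie in B₁ and have entries in H, while for `L_G` the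
quotient is 1. It makes the flag compatible with the relations. -/
theorem sandwich_inv_mul_mem (y : BG P.R) (hy : y ∈ KHLG P.R P.B) (j : ColIndex P.A)
    (w : RowIndex P.A) :
    (sandwich P.gen (P.col y j) (P.row y w))⁻¹ * sandwich P.gen (P.col y j) w ∈ H := by
  obtain ⟨y, hy'⟩ := y
  rcases hy with ⟨a, b, hb, h⟩ | hy
  · obtain rfl : y = kElt (Sum.inl a) (some b) := h
    exact H.mul_mem (H.inv_mem (P.sandwich_mem _ hb _)) (P.sandwich_mem _ hb _)
  · obtain ⟨s, t, x, h, h'⟩ := exists_lTriple hy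
    obtain rfl : y = lElt s t x := h'
    change (sandwich P.gen (some _) (rowMap s t w))⁻¹ * sandwich P.gen (some _) _ ∈ H
    rw [sandwich_some, inv_mul_cancel]
    exact H.one_mem

/-- The factor by which an element of `B_G` acts on the group coordinate in the column `j`. -/
def twist (y : BG P.R) (j : ColIndex P.A) : G :=
  sandwich P.gen j (P.row y (Sum.inl none)) *
    (sandwich P.gen (P.col y j) (P.row y (Sum.inl none)))⁻¹

/-- After the twist of y is split off, each form of a basic pair needs one fact: equal columns,
equal rows, `sandwich_leftRight` for y', or `sandwich_upDown` for y. -/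
theorem twist_mul (y y' : BG P.R) (j : ColIndex P.A)
    (h : y * y' = y ∨ y * y' = y' ∨ y' * y = y ∨ y' * y = y') :
    P.twist (y * y') j = P.twist y j * P.twist y' (P.col y j) := by
  have h1 := P.sandwich_leftRight y j (Sum.inl none) (P.row y' (Sum.inl none))
  rw [twist, twist, h1]
  change sandwich P.gen j (P.row y (P.row y' (Sum.inl none))) *
    (sandwich P.gen (P.col y' (P.col y j)) (P.row y (P.row y' (Sum.inl none))))⁻¹ = _
  suffices h2 : sandwich P.gen (P.col y j) (P.row y (P.row y' (Sum.inl none))) *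
      (sandwich P.gen (P.col y' (P.col y j)) (P.row y (P.row y' (Sum.inl none))))⁻¹ =
        P.twist y' (P.col y j) by
    rw [← h2]
    group
  have hrow : ∀ (a b : BG P.R) z, P.row (a * b) z = P.row a (P.row b z) := fun _ _ _ => rfl
  have hcol : ∀ (a b : BG P.R) z, P.col (a * b) z = P.col b (P.col a z) := fun _ _ _ => rfl
  rcases h with h | h | h | h
  · have h3 : P.col y' (P.col y j) = P.col y j := by rw [← hcol, h]
    rw [twist, h3, mul_inv_cancel, mul_inv_cancel]
  · rw [← hrow, h, twist]
  · have h3 : ∀ z, P.row y z = P.row y' (P.row y z) := fun z => by rw [← hrow, h]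
    rw [h3]
    exact P.sandwich_leftRight _ _ _ _
  · have h3 : ∀ j, P.col y' j = P.col y (P.col y' j) := fun j => by rw [← hcol, h]
    rw [twist, h3]
    exact P.sandwich_upDown _ _ _ _

/-- The states on which the free idempotent generated semigroup acts: the number of changes
between the two copies of `K_G`, the present copy, the group coordinate, a proposition
recording whether the group coordinate was in `H` at the last change, and the column. -/
structure State where
  /-- the number of changes between the two copies -/
  level : ℕ
  /-- the present copy -/
  side : Bool
  /-- the group coordinate -/
  val : G
  /-- whether the group coordinate was in `H` at the last change -/
  flag : Prop
  /-- the column -/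
  column : ColIndex P.A

variable {P}

/-- The action of an element of `K_H ∪ L_G`. -/
def State.stepBase (y : BG P.R) (s : P.State) : P.State where
  level := s.level
  side := s.side
  val := s.val * P.twist y s.column
  flag := s.flag
  column := P.col y s.column

/-- The action of an element of one of the two copies of `K_G`. -/
def State.stepCopy (c : Bool) (y : BG P.R) (s : P.State) : P.State where
  level := if s.side = c then s.level else s.level + 1
  side := c
  val := s.val * P.twist y s.column
  flag := if s.side = c then s.flag else
    s.val * sandwich P.gen s.column (P.row y (Sum.inl none)) ∈ H
  column := P.col y s.column

/-- The action of an element of `W(B_G)`. -/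
def act : WSem (BG P.R) → Option P.State → Option P.State
  | WSem.base y => Option.map (State.stepBase y)
  | WSem.prime y => Option.map (State.stepCopy true y)
  | WSem.dprime y => Option.map (State.stepCopy false y)
  | WSem.zero => fun _ => none

theorem stepBase_stepBase {y y' : BG P.R}
    (h : y * y' = y ∨ y * y' = y' ∨ y' * y = y ∨ y' * y = y') (s : P.State) :
    (s.stepBase y).stepBase y' = s.stepBase (y * y') := by
  simp only [State.stepBase, P.twist_mul y y' _ h, mul_assoc]
  rfl

/-- If the step changes the copy, the two group elements tested by the flag differ by a right factor
from `sandwich_inv_mul_mem`, so one is in H exactly when the other is. -/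
theorem stepBase_stepCopy (c : Bool) {y y' : BG P.R}
    (h : y * y' = y ∨ y * y' = y' ∨ y' * y = y ∨ y' * y = y') (hy : y ∈ KHLG P.R P.B)
    (s : P.State) : (s.stepBase y).stepCopy c y' = s.stepCopy c (y * y') := by
  simp only [State.stepBase, State.stepCopy, P.twist_mul y y' _ h, mul_assoc]
  congr 1
  refine if_congr Iff.rfl rfl (propext ?_)
  have h1 := P.sandwich_leftRight y s.column (Sum.inl none) (P.row y' (Sum.inl none))
  have h2 := P.sandwich_inv_mul_mem y hy s.column (P.row y' (Sum.inl none))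
  rw [twist, h1, mul_assoc, ← mul_assoc]
  exact H.mul_mem_cancel_right h2

theorem stepCopy_stepBase (c : Bool) {y y' : BG P.R}
    (h : y * y' = y ∨ y * y' = y' ∨ y' * y = y ∨ y' * y = y') (hy : (y : BiTrans P.A) ∈ KG P.A)
    (s : P.State) : (s.stepCopy c y).stepBase y' = s.stepCopy c (y * y') := by
  simp only [State.stepBase, State.stepCopy, P.twist_mul y y' _ h, mul_assoc]
  congr 1
  obtain ⟨y, _⟩ := y
  obtain ⟨i, j, rfl⟩ := hy
  rfl

theorem isBasicPair_iff {S : Type*} [Semigroup S] (x y : S) :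
    IsBasicPair x y ↔ x * y = x ∨ x * y = y ∨ y * x = x ∨ y * x = y := by
  constructor
  · rintro ⟨z, rfl | rfl, h | h⟩
    · exact Or.inl h.symm
    · exact Or.inr (Or.inr (Or.inl h.symm))
    · exact Or.inr (Or.inl h.symm)
    · exact Or.inr (Or.inr (Or.inr h.symm))
  · rintro (h | h | h | h)
    · exact ⟨x, Or.inl rfl, Or.inl h.symm⟩
    · exact ⟨y, Or.inr rfl, Or.inl h.symm⟩
    · exact ⟨x, Or.inl rfl, Or.inr h.symm⟩
    · exact ⟨y, Or.inr rfl, Or.inr h.symm⟩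

/-- The element of `S` that underlies a non-zero element of `W(S)`. -/
def wUnder {S : Type*} : WSem S → Option S
  | WSem.base y => some y
  | WSem.prime y => some y
  | WSem.dprime y => some y
  | WSem.zero => none

theorem act_act (x y : P.Band) (h : IsBasicPair x y) (s : Option P.State) :
    act y.1 (act x.1 s) = act (x * y).1 s := by
  have h' : x.1 * y.1 = x.1 ∨ x.1 * y.1 = y.1 ∨ y.1 * x.1 = x.1 ∨ y.1 * x.1 = y.1 := by
    have := (isBasicPair_iff x y).1 h
    simp only [Subtype.ext_iff] at this
    exact this
  have hu := h'.imp (congrArg wUnder) (Or.imp (congrArg wUnder)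
    (Or.imp (congrArg wUnder) (congrArg wUnder)))
  clear h h'
  change _ = act (x.1 * y.1) s
  cases s with
  | none => rcases x with ⟨_ | _ | _ | _, _⟩ <;> rcases y with ⟨_ | _ | _ | _, _⟩ <;> rfl
  | some s =>
    obtain ⟨x, ((⟨x, hx, rfl⟩ | ⟨x, hx, rfl⟩) | ⟨x, hx, rfl⟩) | rfl⟩ := x <;>
    obtain ⟨y, ((⟨y, hy, rfl⟩ | ⟨y, hy, rfl⟩) | ⟨y, hy, rfl⟩) | rfl⟩ := y <;>
    first
    | rfl
    | (have hb : x * y = x ∨ x * y = y ∨ y * x = x ∨ y * x = y := by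
        rcases hu with hu | hu | hu | hu
        · exact Or.inl (Option.some.inj hu)
        · exact Or.inr (Or.inl (Option.some.inj hu))
        · exact Or.inr (Or.inr (Or.inl (Option.some.inj hu)))
        · exact Or.inr (Or.inr (Or.inr (Option.some.inj hu)))
       first
       | exact congrArg some (stepBase_stepBase hb s)
       | exact congrArg some (stepBase_stepCopy _ hb hx s)
       -- A second step in the same copy unfolds to a base step, so this also covers products within
       -- one copy.
       | exact congrArg some (stepCopy_stepBase _ hb hx s))
    -- Elements of different copies have product zero and so never form a basic pair.
    | (rcases hu with hu | hu | hu | hu <;> exact (Option.some_ne_none _ hu.symm).elim)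

end TriangularPresentation

/-! ### Maximal subgroups inside a copy -/

namespace IsCopy

variable {G : Type u} [Group G] {H : Subgroup G} {P : TriangularPresentation.{u, v} G H}
  {Q : Type*} [Semigroup Q] {l : ∀ s t x, LTriple P.R s t x → Q}
  {k : AOne P.A → ∀ b, InBOne P.B b → Q} {m : RowIndex P.A → ColIndex P.A → Q}

theorem map_coord (hm : IsCopy P.R P.B l k m) {T : Type*} [Semigroup T] (hT : ∀ x : T, x * x = x)
    (π : Q →ₙ* T) (i : RowIndex P.A) (g : G) (j : ColIndex P.A) :
    π (hm.coord i g j) = π (m i j) := by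
  -- With p the sandwich entry, g·p·(p⁻¹g⁻¹p⁻¹) = p⁻¹, the group coordinate of `m i j`.
  refine eq_of_mul_eq_of_band hT
    (y := π (hm.coord i ((sandwich P.gen j i)⁻¹ * g⁻¹ * (sandwich P.gen j i)⁻¹) j)) ?_ ?_ <;>
  · rw [hm.eq_coord, ← map_mul, coord_mul_coord]
    congr 2
    group

/-- If coordinates are determined by the elements, then the maximal subgroups in the completely
simple semigroup formed by a copy of `K_G` are isomorphic to `G`. -/
theorem nonempty_mulEquiv (hm : IsCopy P.R P.B l k m) (e : Idempotents Q) (i : RowIndex P.A)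
    (j : ColIndex P.A) (g : G) (he : e.1 = hm.coord i g j)
    (hinj : ∀ g g' : G, hm.coord i g j = hm.coord i g' j → g = g')
    (hsurj : ∀ x : MaximalSubgroup e, ∃ g, x.1 = hm.coord i g j) :
    Nonempty (MaximalSubgroup e ≃* G) := by
  have hg : g * sandwich P.gen j i = 1 := by
    have h1 : e.1 * e.1 = e.1 := e.2
    rw [he, coord_mul_coord] at h1
    have h2 := hinj _ _ h1
    simpa using h2
  have hg' : g = (sandwich P.gen j i)⁻¹ := eq_inv_of_mul_eq_one_left hg
  have hmul : ∀ a b : G, hm.coord i (a * g) j * hm.coord i (b * g) j = hm.coord i (a * b * g) j := by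
    intro a b
    rw [coord_mul_coord]
    congr 1
    rw [hg']
    group
  have hone : hm.coord i (1 * g) j = e.1 := by rw [one_mul, he]
  have hH : ∀ a : G, GreenH (hm.coord i (a * g) j) e := fun a => by
    refine (greenH_iff e _).2 ⟨?_, ?_, hm.coord i (a⁻¹ * g) j, ?_, ?_, ?_, ?_⟩ <;>
    · rw [← hone, hmul]
      simp
  let φ : G →* MaximalSubgroup e :=
    MonoidHom.mk' (fun a => ⟨hm.coord i (a * g) j, hH a⟩) fun a b => Subtype.ext (hmul a b).symm
  refine ⟨(MulEquiv.ofBijective φ ⟨fun a b hab => ?_, fun x => ?_⟩).symm⟩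
  · exact mul_right_cancel (hinj _ _ (congrArg Subtype.val hab))
  · obtain ⟨a, ha⟩ := hsurj x
    refine ⟨a * g⁻¹, Subtype.ext ?_⟩
    change hm.coord i (a * g⁻¹ * g) j = _
    rw [inv_mul_cancel_right, ha]

end IsCopy

/-! ### The action of `IG` and the faithfulness of coordinates -/

namespace TriangularPresentation

variable {G : Type u} [Group G] {H : Subgroup G} {P : TriangularPresentation.{u, v} G H}

/-- The action of the free idempotent generated semigroup on the states. -/
def runHom (P : TriangularPresentation.{u, v} G H) :
    IG P.Band →ₙ* (Function.End (Option P.State))ᵐᵒᵖ :=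
  igLift (fun e => MulOpposite.op (act e.1.1 : Option P.State → Option P.State))
    fun e f g hb hg => by
      refine MulOpposite.unop_injective (funext fun s => ?_)
      refine (act_act e.1 f.1 hb s).trans ?_
      rw [hg]
      rfl

/-- The action of an element of the free idempotent generated semigroup on the states. -/
def run (x : IG P.Band) : Option P.State → Option P.State := (P.runHom x).unop

theorem run_mul (x y : IG P.Band) (s : Option P.State) : run (x * y) s = run y (run x s) := by
  unfold run
  rw [map_mul]; rfl

/-- The elements `m i j` of the free idempotent generated semigroup satisfy `IsCopy` and act on
the states like the elements of the copy `c` of `K_G`. -/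
structure ActsAs (P : TriangularPresentation.{u, v} G H) (c : Bool)
    (m : RowIndex P.A → ColIndex P.A → IG P.Band) : Prop where
  isCopy : IsCopy P.R P.B (fun s t x h => P.ig (P.bandL s t x h))
    (fun a b h => P.ig (P.bandK a b h)) m
  run_eq : ∀ i j s, run (m i j) (some s) = some (State.stepCopy c (P.kG i j) s)

theorem actsAs_prime : P.ActsAs true (fun i j => P.ig (P.bandP i j)) :=
  ⟨P.isCopy_prime, fun _ _ _ => rfl⟩

theorem actsAs_dprime : P.ActsAs false (fun i j => P.ig (P.bandD i j)) :=
  ⟨P.isCopy_dprime, fun _ _ _ => rfl⟩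

theorem stepCopy_kG (c : Bool) (i : RowIndex P.A) (j j' : ColIndex P.A) (n : ℕ) (x : G)
    (f : Prop) : State.stepCopy c (P.kG i j) ⟨n, c, x, f, j'⟩ =
      ⟨n, c, x * (sandwich P.gen j' i * (sandwich P.gen j i)⁻¹), f, j⟩ := by
  simp only [State.stepCopy, if_true]
  rfl

section

variable {c : Bool} {m : RowIndex P.A → ColIndex P.A → IG P.Band}

theorem run_emb (hm : P.ActsAs c m) (g : G) (n : ℕ) (x : G) (f : Prop) :
    run (hm.isCopy.emb g) (some ⟨n, c, x, f, some none⟩) =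
      some ⟨n, c, x * g, f, some none⟩ := by
  have h1 : ∀ (n : ℕ) (x : G) (f : Prop), run (hm.isCopy.emb 1) (some ⟨n, c, x, f, some none⟩) =
      some ⟨n, c, x, f, some none⟩ := fun n x f => by
    rw [IsCopy.emb_one, hm.run_eq, stepCopy_kG, mul_inv_cancel, mul_one]
  let K : Subgroup G :=
    { carrier := {g | ∀ (n : ℕ) (x : G) (f : Prop),
        run (hm.isCopy.emb g) (some ⟨n, c, x, f, some none⟩) =
          some ⟨n, c, x * g, f, some none⟩}
      one_mem' := fun n x f => by rw [h1, mul_one]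
      mul_mem' := by
        intro a b ha hb n x f
        rw [IsCopy.emb_mul, run_mul, ha, hb, mul_assoc]
      inv_mem' := by
        intro a ha n x f
        -- Starting from x·a⁻¹, the action of a ends at x, so the action of a⁻¹ on x becomes that of
        -- a·a⁻¹.
        have h2 := ha n (x * a⁻¹) f
        rw [inv_mul_cancel_right] at h2
        rw [← h2, ← run_mul, ← IsCopy.emb_mul, mul_inv_cancel, h1] }
  suffices h : K = ⊤ from (h ▸ Subgroup.mem_top g : g ∈ K) n x f
  have hgen : Subgroup.closure (Set.range P.gen) = ⊤ := by
    rw [← FreeGroup.range_lift_eq_closure, MonoidHom.range_eq_top]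
    exact P.gen_surjective
  rw [eq_top_iff, ← hgen, Subgroup.closure_le]
  rintro _ ⟨a, rfl⟩ n x f
  have h2 : hm.isCopy.emb (P.gen a) = _ := hm.isCopy.emb_genOne (some a)
  rw [h2, IsCopy.genElt, run_mul, run_mul, hm.run_eq, stepCopy_kG, hm.run_eq, stepCopy_kG,
    hm.run_eq, stepCopy_kG]
  simp [sandwich, genOne]

theorem run_coord (hm : P.ActsAs c m) (i : RowIndex P.A) (g : G) (j : ColIndex P.A)
    (s : P.State) : run (hm.isCopy.coord i g j) (some s) =
      some (State.stepCopy c (P.kG (Sum.inl none) j)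
        { State.stepCopy c (P.kG i (some none)) s with
          val := (State.stepCopy c (P.kG i (some none)) s).val * g }) := by
  have h : run (hm.isCopy.emb g) (some (State.stepCopy c (P.kG i (some none)) s)) = _ :=
    run_emb hm g _ _ _
  rw [IsCopy.coord, run_mul, run_mul, hm.run_eq, h, hm.run_eq]
  rfl

theorem run_mem_coords (hm : P.ActsAs c m) {x : IG P.Band} (hx : x ∈ hm.isCopy.coords)
    (s : P.State) : ∃ s', run x (some s) = some s' ∧ s'.side = c ∧
      s'.level = if s.side = c then s.level else s.level + 1 := by
  obtain ⟨i, g, j, rfl⟩ := hx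
  exact ⟨_, run_coord hm i g j s, rfl, if_pos rfl⟩

/-- The group element reached from a state already in copy c is g between two factors that do not
depend on g. -/
theorem coord_injective (hm : P.ActsAs c m) (i : RowIndex P.A) (j : ColIndex P.A) (g g' : G)
    (h : hm.isCopy.coord i g j = hm.isCopy.coord i g' j) : g = g' := by
  have h1 := congrArg (fun x => run x (some ⟨0, c, 1, True, none⟩)) h
  simp only [run_coord hm] at h1
  have h2 := congrArg State.val (Option.some.inj h1)
  exact mul_left_cancel (mul_right_cancel h2 :)

end

end TriangularPresentation

/-! ### The elements of `IG` and its maximal subgroups -/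

namespace TriangularPresentation

variable {G : Type u} [Group G] {H : Subgroup G} (P : TriangularPresentation.{u, v} G H)

/-- Membership in `K_H ∪ L_G`. -/
def IsV (x : P.Band) : Prop := (∃ s t y h, x = P.bandL s t y h) ∨ ∃ a b h, x = P.bandK a b h

/-- Properties of a product of elements of `K_G'` and `K_G''` that involves both of them. -/
def IsMixed (x : IG P.Band) : Prop :=
  igProj x = P.bandZ ∧ ∀ s : P.State, ∃ s', run x (some s) = some s' ∧ s.level < s'.level

variable {P}

theorem IsV.mul {x y : P.Band} (hx : P.IsV x) (hy : P.IsV y) :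
    ∃ z, P.IsV z ∧ P.ig x * P.ig y = P.ig z := by
  have key : ∀ s t w h a b h', P.ig (P.bandL s t w h) * P.ig (P.bandK a b h') =
      P.ig (P.bandK s b h') := fun s t w h a b h' =>
    P.ig_mul_eq _ _ _ (Or.inr (Or.inr (Or.inr rfl))) rfl
  rcases hx with ⟨s, t, w, h, rfl⟩ | ⟨a, b, h, rfl⟩ <;>
    rcases hy with ⟨s', t', w', h', rfl⟩ | ⟨a', b', h', rfl⟩
  · have e : P.bandL s t w h * P.bandL s' t' w' h' = P.bandL s t w h :=
      Subtype.ext (congrArg WSem.base (Subtype.ext (lElt_mul_lElt _ _ _ _ _ _)))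
    exact ⟨_, Or.inl ⟨s, t, w, h, rfl⟩, P.ig_mul_eq _ _ _ (Or.inl e) e⟩
  · exact ⟨_, Or.inr ⟨_, _, h', rfl⟩, key _ _ _ _ _ _ _⟩
  · exact ⟨_, Or.inr ⟨a, b, h, rfl⟩, P.ig_mul_eq _ _ _ (Or.inl rfl) rfl⟩
  · refine ⟨_, Or.inr ⟨a, b', h', rfl⟩, ?_⟩
    -- Two elements of `K_H` need not form a basic pair. The element e_ā is absorbed on the left and
    -- moves the right factor into row a, where the pair is basic.
    have hl : LTriple P.R a a none := Or.inr (Or.inl ⟨rfl, rfl⟩)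
    calc _ = P.ig (P.bandK a b h) * P.ig (P.bandL a a none hl) * P.ig (P.bandK a' b' h') := by
          rw [P.ig_mul_eq _ (P.bandL a a none hl) (P.bandK a b h) (Or.inl rfl) rfl]
      _ = P.ig (P.bandK a b h) * P.ig (P.bandK a b' h') := by rw [mul_assoc, key]
      _ = _ := P.ig_mul_eq _ _ _ (Or.inr (Or.inl rfl)) rfl

theorem IsV.run_eq {x : P.Band} (hx : P.IsV x) (s : P.State) :
    ∃ s', run (P.ig x) (some s) = some s' ∧ s'.side = s.side ∧ s'.level = s.level := by
  rcases hx with ⟨s, t, w, h, rfl⟩ | ⟨a, b, h, rfl⟩ <;> exact ⟨_, rfl, rfl, rfl⟩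

theorem IsV.exists_base {x : P.Band} (hx : P.IsV x) : ∃ y, x.1 = WSem.base y := by
  rcases hx with ⟨s, t, w, h, rfl⟩ | ⟨a, b, h, rfl⟩ <;> exact ⟨_, rfl⟩

section

variable {c : Bool} {m : RowIndex P.A → ColIndex P.A → IG P.Band}

theorem IsV.mul_mem_coords (hm : P.ActsAs c m) {v : P.Band} (hv : P.IsV v) {x : IG P.Band}
    (hx : x ∈ hm.isCopy.coords) : P.ig v * x ∈ hm.isCopy.coords := by
  rcases hv with ⟨s, t, w, h, rfl⟩ | ⟨a, b, h, rfl⟩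
  · exact hm.isCopy.l_mul_mem_coords hx h
  · exact hm.isCopy.k_mul_mem_coords hx h

theorem IsV.mem_coords_mul (hm : P.ActsAs c m) {v : P.Band} (hv : P.IsV v) {x : IG P.Band}
    (hx : x ∈ hm.isCopy.coords) : x * P.ig v ∈ hm.isCopy.coords := by
  rcases hv with ⟨s, t, w, h, rfl⟩ | ⟨a, b, h, rfl⟩
  · exact hm.isCopy.mul_l_mem_coords hx h
  · exact hm.isCopy.mul_k_mem_coords hx h

end

theorem exists_igProj_prime {x : IG P.Band} (hx : x ∈ (P.actsAs_prime).isCopy.coords) :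
    ∃ i j, igProj x = P.bandP i j := by
  obtain ⟨i, g, j, rfl⟩ := hx
  exact ⟨i, j, P.actsAs_prime.isCopy.map_coord P.band_mul_self igProj i g j⟩

theorem exists_igProj_dprime {x : IG P.Band} (hx : x ∈ (P.actsAs_dprime).isCopy.coords) :
    ∃ i j, igProj x = P.bandD i j := by
  obtain ⟨i, g, j, rfl⟩ := hx
  exact ⟨i, j, P.actsAs_dprime.isCopy.map_coord P.band_mul_self igProj i g j⟩

theorem isMixed_mul {c : Bool} {m m' : RowIndex P.A → ColIndex P.A → IG P.Band}
    (hm : P.ActsAs c m) (hm' : P.ActsAs (!c) m') {x y : IG P.Band}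
    (hx : x ∈ hm.isCopy.coords) (hy : y ∈ hm'.isCopy.coords)
    (h : igProj (x * y) = P.bandZ) : P.IsMixed (x * y) := by
  refine ⟨h, fun s => ?_⟩
  obtain ⟨s', h1, h2, h3⟩ := run_mem_coords hm hx s
  obtain ⟨s'', h4, -, h5⟩ := run_mem_coords hm' hy s'
  refine ⟨s'', by rw [run_mul, h1, h4], ?_⟩
  -- The second factor meets a state on the opposite side, so it adds a change.
  rw [h5, h2, if_neg (by cases c <;> simp), h3]
  split <;> omega

theorem bandZ_of_mul (x : P.Band) : x * P.bandZ = P.bandZ := by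
  rcases P.band_cases x with ⟨_, _, _, _, rfl⟩ | ⟨_, _, _, rfl⟩ | ⟨_, _, rfl⟩ | ⟨_, _, rfl⟩ | rfl <;>
  rfl

theorem IsMixed.mul {x : P.Band} (hx : x ≠ P.bandZ) {y : IG P.Band} (hy : P.IsMixed y) :
    P.IsMixed (P.ig x * y) := by
  refine ⟨by rw [map_mul, hy.1, bandZ_of_mul], fun s => ?_⟩
  have h : ∃ s', run (P.ig x) (some s) = some s' ∧ s.level ≤ s'.level := by
    rcases P.band_cases x with ⟨_, _, _, _, rfl⟩ | ⟨_, _, _, rfl⟩ | ⟨i, j, rfl⟩ | ⟨i, j, rfl⟩ | rfl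
    · exact ⟨_, rfl, le_rfl⟩
    · exact ⟨_, rfl, le_rfl⟩
    · exact ⟨_, P.actsAs_prime.run_eq i j s, by simp only [State.stepCopy]; split <;> omega⟩
    · exact ⟨_, P.actsAs_dprime.run_eq i j s, by simp only [State.stepCopy]; split <;> omega⟩
    · exact absurd rfl hx
  obtain ⟨s', h1, h2⟩ := h
  obtain ⟨s'', h3, h4⟩ := hy.2 s'
  exact ⟨s'', by rw [run_mul, h1, h3], h2.trans_lt h4⟩

/-- Acting twice gives a strictly larger level than acting once. -/
theorem IsMixed.not_isIdempotentElem {x : IG P.Band} (hx : P.IsMixed x) :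
    ¬ IsIdempotentElem x := by
  intro h
  obtain ⟨s, h1, -⟩ := hx.2 ⟨0, true, 1, True, none⟩
  obtain ⟨s', h2, h3⟩ := hx.2 s
  have h4 : run (x * x) (some ⟨0, true, 1, True, none⟩) = some s' := by rw [run_mul, h1, h2]
  rw [h.eq, h1] at h4
  rw [Option.some.inj h4] at h3
  exact lt_irrefl _ h3

theorem ig_cases (x : IG P.Band) : (∃ v, P.IsV v ∧ x = P.ig v) ∨
    x ∈ (P.actsAs_prime).isCopy.coords ∨ x ∈ (P.actsAs_dprime).isCopy.coords ∨
      x = P.ig P.bandZ ∨ P.IsMixed x := by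
  have hgen : ∀ y : P.Band, P.IsV y ∨ P.ig y ∈ (P.actsAs_prime).isCopy.coords ∨
      P.ig y ∈ (P.actsAs_dprime).isCopy.coords ∨ y = P.bandZ := fun y => by
    rcases P.band_cases y with h | h | ⟨i, j, rfl⟩ | ⟨i, j, rfl⟩ | h
    · exact Or.inl (Or.inl h)
    · exact Or.inl (Or.inr h)
    · exact Or.inr (Or.inl (P.isCopy_prime.m_mem_coords i j))
    · exact Or.inr (Or.inr (Or.inl (P.isCopy_dprime.m_mem_coords i j)))
    · exact Or.inr (Or.inr (Or.inr h))
  induction x using ig_induction with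
  | h1 e =>
    rcases hgen e.1 with h | h | h | h
    · exact Or.inl ⟨_, h, rfl⟩
    · exact Or.inr (Or.inl h)
    · exact Or.inr (Or.inr (Or.inl h))
    · exact Or.inr (Or.inr (Or.inr (Or.inl (congrArg P.ig h))))
  | h2 e x hx =>
    change (∃ v, P.IsV v ∧ P.ig e.1 * x = P.ig v) ∨ P.ig e.1 * x ∈ _ ∨ P.ig e.1 * x ∈ _ ∨
      P.ig e.1 * x = _ ∨ P.IsMixed (P.ig e.1 * x)
    obtain ⟨e, he⟩ := e
    dsimp only
    by_cases hz : e = P.bandZ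
    · rw [hz, P.ig_bandZ_mul]
      exact Or.inr (Or.inr (Or.inr (Or.inl rfl)))
    rcases hx with ⟨v, hv, rfl⟩ | hx | hx | rfl | hx
    · rcases hgen e with h | h | h | h
      · exact Or.inl (h.mul hv)
      · exact Or.inr (Or.inl (hv.mem_coords_mul P.actsAs_prime h))
      · exact Or.inr (Or.inr (Or.inl (hv.mem_coords_mul P.actsAs_dprime h)))
      · exact absurd h hz
    · rcases hgen e with h | h | h | h
      · exact Or.inr (Or.inl (h.mul_mem_coords P.actsAs_prime hx))
      · exact Or.inr (Or.inl (P.isCopy_prime.mul_mem_coords h hx))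
      · refine Or.inr (Or.inr (Or.inr (Or.inr (isMixed_mul P.actsAs_dprime P.actsAs_prime h hx ?_))))
        obtain ⟨i, j, h1⟩ := exists_igProj_dprime h
        obtain ⟨i', j', h2⟩ := exists_igProj_prime hx
        rw [map_mul, h1, h2]; rfl
      · exact absurd h hz
    · rcases hgen e with h | h | h | h
      · exact Or.inr (Or.inr (Or.inl (h.mul_mem_coords P.actsAs_dprime hx)))
      · refine Or.inr (Or.inr (Or.inr (Or.inr (isMixed_mul P.actsAs_prime P.actsAs_dprime h hx ?_))))
        obtain ⟨i, j, h1⟩ := exists_igProj_prime h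
        obtain ⟨i', j', h2⟩ := exists_igProj_dprime hx
        rw [map_mul, h1, h2]; rfl
      · exact Or.inr (Or.inr (Or.inl (P.isCopy_dprime.mul_mem_coords h hx)))
      · exact absurd h hz
    · exact Or.inr (Or.inr (Or.inr (Or.inl (P.ig_mul_bandZ e))))
    · exact Or.inr (Or.inr (Or.inr (Or.inr (hx.mul hz))))

theorem igProj_eq_of_maximalSubgroup (e : Idempotents (IG P.Band)) (x : MaximalSubgroup e) :
    igProj x.1 = igProj e.1 := by
  obtain ⟨h1, h2, y, -, -, h3, -⟩ := (greenH_iff e x.1).1 x.2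
  refine eq_of_mul_eq_of_band P.band_mul_self (y := igProj y) ?_ ?_
  · rw [← map_mul, h2]
  · rw [← map_mul, h3]

/-- All members of the H-class have the same image in the band. This image fixes the class in
`ig_cases`, and within a copy also the row and column, so only the group coordinate is free. -/
theorem subsingleton_or_nonempty_mulEquiv (e : Idempotents (IG P.Band)) :
    Subsingleton (MaximalSubgroup e) ∨ Nonempty (MaximalSubgroup e ≃* G) := by
  have hsub : (∀ x : MaximalSubgroup e, x.1 = e.1) → Subsingleton (MaximalSubgroup e) :=
    fun h => ⟨fun x y => Subtype.ext ((h x).trans (h y).symm)⟩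
  have hcopy : ∀ (c : Bool) (m : RowIndex P.A → ColIndex P.A → IG P.Band) (hm : P.ActsAs c m),
      e.1 ∈ hm.isCopy.coords → (∀ x : IG P.Band, igProj x = igProj e.1 → x ∈ hm.isCopy.coords) →
      (∀ i j i' j', igProj (m i j) = igProj (m i' j') → i = i' ∧ j = j') →
      Nonempty (MaximalSubgroup e ≃* G) := by
    rintro c m hm ⟨i, g, j, he⟩ h1 h2
    refine hm.isCopy.nonempty_mulEquiv e i j g he (coord_injective hm i j) fun x => ?_
    obtain ⟨i', g', j', hx⟩ := h1 _ (igProj_eq_of_maximalSubgroup e x)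
    have h3 : igProj (hm.isCopy.coord i' g' j') = igProj (hm.isCopy.coord i g j) :=
      (congrArg igProj hx).symm.trans ((igProj_eq_of_maximalSubgroup e x).trans (congrArg igProj he))
    rw [hm.isCopy.map_coord P.band_mul_self, hm.isCopy.map_coord P.band_mul_self] at h3
    obtain ⟨rfl, rfl⟩ := h2 _ _ _ _ h3
    exact ⟨g', hx⟩
  have hk : ∀ i j i' j', P.kG i j = P.kG i' j' → i = i' ∧ j = j' := fun i j i' j' h => by
    have h' := congrArg (fun y : BG P.R => (P.row y (Sum.inl none), P.col y none)) h
    exact ⟨congrArg Prod.fst h', congrArg Prod.snd h'⟩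
  rcases ig_cases e.1 with ⟨v, hv, he⟩ | he | he | he | he
  · left
    refine hsub fun x => ?_
    have hp := congrArg Subtype.val (igProj_eq_of_maximalSubgroup e x)
    obtain ⟨y, hy⟩ := hv.exists_base
    have he' : (igProj e.1).1 = WSem.base y := by rw [he]; exact hy
    rw [he'] at hp
    rcases ig_cases x.1 with ⟨w, hw, hx⟩ | hx | hx | hx | hx
    · have h1 := igProj_eq_of_maximalSubgroup e x
      rw [hx, he] at h1
      rw [hx, he]
      exact congrArg P.ig h1
    · obtain ⟨i, j, h⟩ := exists_igProj_prime hx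
      rw [h] at hp
      exact nomatch hp
    · obtain ⟨i, j, h⟩ := exists_igProj_dprime hx
      rw [h] at hp
      exact nomatch hp
    · rw [hx] at hp
      exact nomatch hp
    · rw [hx.1] at hp
      exact nomatch hp
  · right
    obtain ⟨i, j, hij⟩ := exists_igProj_prime he
    refine hcopy _ _ P.actsAs_prime he (fun x hx => ?_) fun i j i' j' h =>
      hk _ _ _ _ (WSem.prime.inj (congrArg Subtype.val h))
    rw [hij] at hx
    have hp := congrArg Subtype.val hx
    rcases ig_cases x with ⟨w, hw, rfl⟩ | hx | hx | rfl | hx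
    · obtain ⟨y, hy⟩ := hw.exists_base
      exact nomatch hy.symm.trans hp
    · exact hx
    · obtain ⟨i', j', h⟩ := exists_igProj_dprime hx
      rw [h] at hp
      exact nomatch hp
    · exact nomatch hp
    · rw [hx.1] at hp
      exact nomatch hp
  · right
    obtain ⟨i, j, hij⟩ := exists_igProj_dprime he
    refine hcopy _ _ P.actsAs_dprime he (fun x hx => ?_) fun i j i' j' h =>
      hk _ _ _ _ (WSem.dprime.inj (congrArg Subtype.val h))
    rw [hij] at hx
    have hp := congrArg Subtype.val hx
    rcases ig_cases x with ⟨w, hw, rfl⟩ | hx | hx | rfl | hx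
    · obtain ⟨y, hy⟩ := hw.exists_base
      exact nomatch hy.symm.trans hp
    · obtain ⟨i', j', h⟩ := exists_igProj_prime hx
      rw [h] at hp
      exact nomatch hp
    · exact hx
    · exact nomatch hp
    · rw [hx.1] at hp
      exact nomatch hp
  · left
    refine hsub fun x => ?_
    obtain ⟨h1, -⟩ := (greenH_iff e x.1).1 x.2
    refine h1.symm.trans ?_
    have h2 := P.ig_bandZ_mul x.1
    rwa [← he] at h2
  · exact absurd e.2 he.not_isIdempotentElem

/-- The words `g' · 1''` and `1' · g''` represent the same element exactly for `g ∈ H`. -/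
theorem emb_mul_eq_iff (g : G) :
    P.isCopy_prime.emb g * P.ig (P.bandD (Sum.inl none) (some none)) =
      P.ig (P.bandP (Sum.inl none) (some none)) * P.isCopy_dprime.emb g ↔ g ∈ H := by
  refine ⟨fun h => ?_, fun h => P.isCopy_prime.emb_mul_base_of_mem P.isCopy_dprime h⟩
  -- On the right-hand side the change of copy now happens at 1'', before g acts.
  rw [← P.isCopy_dprime.base_mul_emb g] at h
  have h1 := congrArg (fun x => run x (some ⟨0, true, 1, True, some none⟩)) h
  have e1 := run_emb P.actsAs_prime g 0 1 True
  have e2 : run (P.isCopy_dprime.emb g) (run (P.ig (P.bandD (Sum.inl none) (some none)))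
    (run (P.ig (P.bandP (Sum.inl none) (some none))) (some ⟨0, true, 1, True, some none⟩))) = _ :=
      run_emb P.actsAs_dprime g 1 _ _
  simp only [run_mul] at h1
  rw [e2] at h1
  have e3 : run (P.isCopy_prime.emb g) (some ⟨0, true, 1, True, some none⟩) = _ := e1
  rw [e3] at h1
  -- The flags record the group element at the change: g on the left-hand side, 1 on the right-hand
  -- side.
  have h2 : (1 * g * 1 ∈ H) = (1 * (1 * 1⁻¹) * 1 ∈ H) := congrArg State.flag (Option.some.inj h1)
  simpa [H.one_mem] using h2

end TriangularPresentation

/-! ### Existence of triangular presentations -/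

/-- If `gen` enumerates the values of all words of length at most `N`, where `N` bounds the lengths
of the relators of a finite presentation of `G`, then the relations `ab = c` that hold in `G`
define `G`. -/
theorem ker_lift_eq_normalClosure_of_words {G : Type u} [Group G] {n N : ℕ}
    (φ : FreeGroup (Fin n) →* G) (S : Set (FreeGroup (Fin n)))
    (hS : Subgroup.normalClosure S = φ.ker) (hN : 1 ≤ N) (hSN : ∀ r ∈ S, r.toWord.length ≤ N)
    {A : Type v} (gen : A → G)
    (hgen : Set.range gen = (fun w => φ (FreeGroup.mk w)) '' {w | w.length ≤ N}) :
    (FreeGroup.lift gen).ker = Subgroup.normalClosure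
      {w | ∃ a b c : A, gen a * gen b = gen c ∧
        w = FreeGroup.of a * FreeGroup.of b * (FreeGroup.of c)⁻¹} := by
  set K := Subgroup.normalClosure {w | ∃ a b c : A, gen a * gen b = gen c ∧
        w = FreeGroup.of a * FreeGroup.of b * (FreeGroup.of c)⁻¹} with hK
  apply le_antisymm
  · let q : FreeGroup A →* FreeGroup A ⧸ K := QuotientGroup.mk' K
    have hrel : ∀ a b c, gen a * gen b = gen c →
        q (FreeGroup.of a) * q (FreeGroup.of b) = q (FreeGroup.of c) := fun a b c h => by
      rw [← mul_inv_eq_one, ← map_mul, ← map_inv, ← map_mul]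
      exact (QuotientGroup.eq_one_iff _).2 (Subgroup.subset_normalClosure ⟨a, b, c, h, rfl⟩)
    have hone : ∀ a, gen a = 1 → q (FreeGroup.of a) = 1 := fun a h => by
      have := hrel a a a (by rw [h, mul_one])
      exact mul_eq_left.1 this
    have hword : ∀ w : List (Fin n × Bool), w.length ≤ N → ∃ a, gen a = φ (FreeGroup.mk w) :=
      fun w hw => by
        have : φ (FreeGroup.mk w) ∈ Set.range gen := by
          rw [hgen]
          exact ⟨w, hw, rfl⟩
        exact this
    obtain ⟨a₁, ha₁⟩ := hword [] (Nat.zero_le _)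
    rw [show FreeGroup.mk ([] : List (Fin n × Bool)) = 1 from rfl, map_one] at ha₁
    have heq : ∀ a b, gen a = gen b → q (FreeGroup.of a) = q (FreeGroup.of b) := fun a b h => by
      have := hrel a a₁ b (by rw [ha₁, mul_one, h])
      rwa [hone a₁ ha₁, mul_one] at this
    choose l hl using fun x : Fin n => hword [(x, true)] hN
    let θ : FreeGroup (Fin n) →* FreeGroup A ⧸ K := FreeGroup.lift fun x => q (FreeGroup.of (l x))
    -- Every suffix of a short word also has its value among the generators, so adding a letter in
    -- front is one triangular relation.
    have hθ : ∀ w : List (Fin n × Bool), w.length ≤ N → ∀ a, gen a = φ (FreeGroup.mk w) →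
        q (FreeGroup.of a) = θ (FreeGroup.mk w) := by
      intro w
      induction w with
      | nil =>
        intro _ a ha
        rw [show FreeGroup.mk ([] : List (Fin n × Bool)) = 1 from rfl, map_one] at ha ⊢
        exact hone a ha
      | cons xb w ih =>
        intro hw a ha
        have hw' : w.length ≤ N := le_trans (by simp) hw
        obtain ⟨b, hb⟩ := hword w hw'
        obtain ⟨c, hc⟩ := hword [xb] hN
        have hcons : FreeGroup.mk (xb :: w) = FreeGroup.mk [xb] * FreeGroup.mk w := by
          rw [FreeGroup.mul_mk]; rfl
        have h1 : q (FreeGroup.of c) = θ (FreeGroup.mk [xb]) := by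
          obtain ⟨x, _ | _⟩ := xb
          · have h2 : FreeGroup.mk [(x, false)] = (FreeGroup.of x)⁻¹ := rfl
            have h3 : θ (FreeGroup.of x) = q (FreeGroup.of (l x)) := FreeGroup.lift_apply_of
            rw [h2, map_inv, h3, eq_inv_iff_mul_eq_one, hrel c (l x) a₁, hone a₁ ha₁]
            rw [hc, hl, ha₁, ← map_mul, h2, ← map_one φ]
            exact congrArg φ (inv_mul_cancel _)
          · exact (heq _ _ (hc.trans (hl x).symm)).trans FreeGroup.lift_apply_of.symm
        rw [hcons, map_mul, ← ih hw' b hb, ← h1]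
        exact (hrel c b a (by rw [hb, hc, ha, hcons, map_mul])).symm
    -- The relators are short words with value 1, so `hθ` shows that θ kills them.
    have hker : φ.ker ≤ θ.ker := by
      rw [← hS]
      refine Subgroup.normalClosure_le_normal fun r hr => ?_
      have h1 : φ r = 1 := by
        rw [← MonoidHom.mem_ker, ← hS]
        exact Subgroup.subset_normalClosure hr
      have h2 := hθ r.toWord (hSN r hr) a₁ (by rw [FreeGroup.mk_toWord, h1, ha₁])
      rw [hone a₁ ha₁, FreeGroup.mk_toWord] at h2
      exact h2.symm
    have hlift : ∀ a, ∃ w : List (Fin n × Bool), w.length ≤ N ∧ gen a = φ (FreeGroup.mk w) :=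
      fun a => by
        have : gen a ∈ Set.range gen := ⟨a, rfl⟩
        rw [hgen] at this
        obtain ⟨w, hw, h⟩ := this
        exact ⟨w, hw, h.symm⟩
    choose ω hω hω' using hlift
    -- Rewriting each generator as a short word factors q through θ, so everything trivial in `G` is
    -- trivial modulo K.
    let ξ : FreeGroup A →* FreeGroup (Fin n) := FreeGroup.lift fun a => FreeGroup.mk (ω a)
    have h1 : φ.comp ξ = FreeGroup.lift gen := FreeGroup.ext_hom _ _ fun a => by
      rw [MonoidHom.comp_apply, FreeGroup.lift_apply_of, FreeGroup.lift_apply_of, hω']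
    have h2 : θ.comp ξ = q := FreeGroup.ext_hom _ _ fun a => by
      rw [MonoidHom.comp_apply, FreeGroup.lift_apply_of, hθ _ (hω a) a (hω' a)]
    intro w hw
    rw [← h1] at hw
    have h3 : ξ w ∈ θ.ker := hker hw
    rw [← QuotientGroup.eq_one_iff]
    exact (DFunLike.congr_fun h2 w).symm.trans h3
  · refine Subgroup.normalClosure_le_normal ?_
    rintro _ ⟨a, b, c, h, rfl⟩
    rw [SetLike.mem_coe, MonoidHom.mem_ker]
    simp [h]

theorem nonempty_triangularPresentation (G : Type u) [Group G] [hG : Group.IsFinitelyPresented G]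
    (H : Subgroup G) (hH : H.FG) : Nonempty (TriangularPresentation.{u, v} G H) := by
  obtain ⟨n, φ, hφ, S, hSfin, hS⟩ := hG.out
  obtain ⟨T, hT⟩ := hH
  choose τ hτ using hφ
  obtain ⟨N₁, hN₁⟩ := (hSfin.image fun r => r.toWord.length).bddAbove
  obtain ⟨N₂, hN₂⟩ := (T.finite_toSet.image fun t => (τ t).toWord.length).bddAbove
  -- The bound admits single letters, all relators, and words for the generators of H.
  let N := max 1 (max N₁ N₂)
  let F : Set G := (fun w => φ (FreeGroup.mk w)) '' {w | w.length ≤ N}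
  have hF : F.Finite := (List.finite_length_le _ N).image _
  have := hF.to_subtype
  obtain ⟨k, ⟨e⟩⟩ := Finite.exists_equiv_fin F
  let gen : ULift.{v} (Fin k) → G := fun a => (e.symm a.down).1
  have hgen : Set.range gen = F := by
    ext g
    constructor
    · rintro ⟨a, rfl⟩
      exact (e.symm a.down).2
    · intro hg
      exact ⟨⟨e ⟨g, hg⟩⟩, by simp [gen]⟩
  have hmem : ∀ g ∈ F, ∃ a, gen a = g := fun g hg => by
    rw [← hgen] at hg
    exact hg
  refine ⟨{
    A := ULift.{v} (Fin k)
    finite_A := inferInstance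
    gen := gen
    R := {p | gen p.1 * gen p.2.1 = gen p.2.2}
    gen_surjective := ?_
    ker_eq := ker_lift_eq_normalClosure_of_words φ S hS (le_max_left 1 _)
      (fun r hr => (hN₁ ⟨r, hr, rfl⟩).trans ((le_max_left _ _).trans (le_max_right _ _))) gen hgen
    B := {a | gen a ∈ H}
    inv_B := ?_
    closure_B := ?_ }⟩
  · rw [← MonoidHom.range_eq_top, eq_top_iff]
    intro g _
    rw [← hτ g]
    induction τ g using FreeGroup.induction_on with
    | C1 => rw [map_one]; exact one_mem _
    | of x =>
      obtain ⟨a, ha⟩ := hmem (φ (FreeGroup.of x)) ⟨[(x, true)], le_max_left 1 _, rfl⟩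
      rw [← ha]
      exact ⟨FreeGroup.of a, FreeGroup.lift_apply_of⟩
    | inv_of x hx => rw [map_inv]; exact inv_mem hx
    | mul x y hx hy => rw [map_mul]; exact mul_mem hx hy
  · intro b hb
    have hb' : gen b ∈ F := hgen ▸ Set.mem_range_self b
    obtain ⟨w, hw, h⟩ := hb'
    -- The inverse word has the same length, so the inverse is again a value of `gen`.
    obtain ⟨a, ha⟩ := hmem (gen b)⁻¹ ⟨FreeGroup.invRev w, by
      rwa [Set.mem_ofPred_eq, FreeGroup.invRev_length], by
        rw [← h]
        simp only [← map_inv, FreeGroup.inv_mk]⟩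
    exact ⟨a, by rw [Set.mem_ofPred_eq, ha]; exact H.inv_mem hb, ha⟩
  · apply le_antisymm
    · rw [Subgroup.closure_le]
      rintro _ ⟨a, ha, rfl⟩
      exact ha
    · rw [← hT, Subgroup.closure_le]
      intro t ht
      have h1 : (τ t).toWord.length ≤ N :=
        (hN₂ ⟨t, ht, rfl⟩).trans ((le_max_right _ _).trans (le_max_right _ _))
      obtain ⟨a, ha⟩ := hmem t ⟨(τ t).toWord, h1, by simp only [FreeGroup.mk_toWord, hτ]⟩
      refine Subgroup.subset_closure ⟨a, ?_, ha⟩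
      rw [Set.mem_ofPred_eq, ha]
      exact Subgroup.subset_closure ht

/-! ### Reduction of the membership problem to the word problem -/

theorem exists_freeSemigroup_lift_eq {S : Type*} [Semigroup S] {n : ℕ} {f : Fin n → S}
    (hf : Subsemigroup.closure (Set.range f) = ⊤) (x : S) :
    ∃ w : FreeSemigroup (Fin n), FreeSemigroup.lift f w = x := by
  have h : Subsemigroup.closure (Set.range f) ≤ (FreeSemigroup.lift f).srange := by
    rw [Subsemigroup.closure_le]
    rintro _ ⟨i, rfl⟩
    exact ⟨FreeSemigroup.of i, rfl⟩
  rw [hf] at h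
  exact h (Subsemigroup.mem_top x)

theorem lift_append_flatMap {S : Type*} [Semigroup S] {G : Type*} [Group G] {n : ℕ}
    {f : Fin n → S} {ι : Type*} (ψ : G → S) (hψ : ∀ a b, ψ (a * b) = ψ a * ψ b)
    (v : ι → G) (W : ι → FreeSemigroup (Fin n)) (hW : ∀ i, FreeSemigroup.lift f (W i) = ψ (v i))
    (s : List ι) (w : FreeSemigroup (Fin n)) (g : G) (hw : FreeSemigroup.lift f w = ψ g) :
    FreeSemigroup.lift f ⟨w.head, w.tail ++ s.flatMap fun i => (W i).head :: (W i).tail⟩ =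
      ψ (g * (s.map v).prod) := by
  induction s generalizing w g with
  | nil => simpa using hw
  | cons i s ih =>
    have h := ih (w * W i) (g * v i) (by rw [map_mul, hw, hW, hψ])
    simpa [mul_assoc] using h

/-- The words `W i` may be chosen non-constructively: the alphabet is finite, so they form a finite
table. -/
theorem computable_word {n : ℕ} {ι : Type*} [Primcodable ι] [Finite ι]
    (W : ι → FreeSemigroup (Fin n)) (t r : List (Fin n)) :
    Primrec fun s : List ι => t ++ s.flatMap (fun i => (W i).head :: (W i).tail) ++ r :=
  Primrec.list_append.comp
    (Primrec.list_append.comp (Primrec.const t)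
      (Primrec.list_flatMap Primrec.id
        ((Primrec.dom_finite fun i : ι => (W i).head :: (W i).tail).comp₂ Primrec₂.right)))
    (Primrec.const r)

namespace TriangularPresentation

variable {G : Type u} [Group G] {H : Subgroup G} (P : TriangularPresentation.{u, v} G H)

/-- A word for g is translated letter by letter into words for g'·1'' and 1'·g'', which are equal
exactly when g is in H. -/
theorem decidableMembershipProblem (h : SemigroupDecidableWordProblem (IG P.Band)) :
    DecidableMembershipProblem H := by
  obtain ⟨n, f, hf, hdec⟩ := h
  have := P.finite_A
  obtain ⟨k, ⟨e⟩⟩ := Finite.exists_equiv_fin P.A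
  let γ : Fin k → G := fun i => P.gen (e.symm i)
  refine ⟨k, γ, ?_, ?_⟩
  · have : Set.range γ = Set.range P.gen := e.symm.surjective.range_comp P.gen
    rw [this, ← FreeGroup.range_lift_eq_closure, MonoidHom.range_eq_top]
    exact P.gen_surjective
  let val : Fin k × Bool → G := fun i => cond i.2 (γ i.1) (γ i.1)⁻¹
  choose ω hω using exists_freeSemigroup_lift_eq hf
  let W₁ : Fin k × Bool → FreeSemigroup (Fin n) := fun i => ω (P.isCopy_prime.emb (val i))
  let W₂ : Fin k × Bool → FreeSemigroup (Fin n) := fun i => ω (P.isCopy_dprime.emb (val i))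
  let w₁ := ω (P.ig (P.bandP (Sum.inl none) (some none)))
  let w₂ := ω (P.ig (P.bandD (Sum.inl none) (some none)))
  refine ComputablePred.computable_of_manyOneReducible ?_ hdec
  -- Both words begin with a word for 1', which keeps them nonempty when `s` is empty.
  refine ⟨fun s => ((w₁.head, w₁.tail ++ s.flatMap (fun i => (W₁ i).head :: (W₁ i).tail) ++
      (w₂.head :: w₂.tail)),
    (w₁.head, (w₁.tail ++ (w₂.head :: w₂.tail)) ++
      s.flatMap (fun i => (W₂ i).head :: (W₂ i).tail) ++ [])), ?_, fun s => ?_⟩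
  · exact (Primrec.pair (Primrec.pair (Primrec.const _) (computable_word W₁ _ _))
      (Primrec.pair (Primrec.const _) (computable_word W₂ _ _))).to_comp
  · have hval : FreeGroup.lift γ (FreeGroup.mk s) = (s.map val).prod := FreeGroup.lift_mk
    beta_reduce
    rw [hval, ← P.emb_mul_eq_iff]
    have h₁ := lift_append_flatMap P.isCopy_prime.emb P.isCopy_prime.emb_mul val W₁
      (fun i => hω _) s w₁ 1 (by rw [P.isCopy_prime.emb_one]; exact hω _)
    have h₂ := lift_append_flatMap P.isCopy_dprime.emb P.isCopy_dprime.emb_mul val W₂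
      (fun i => hω _) s w₂ 1 (by rw [P.isCopy_dprime.emb_one]; exact hω _)
    rw [one_mul] at h₁ h₂
    have e₁ := congrArg (· * FreeSemigroup.lift f w₂) h₁
    have e₂ := congrArg (FreeSemigroup.lift f w₁ * ·) h₂
    simp only [← map_mul] at e₁ e₂
    rw [hω] at e₁ e₂
    rw [← e₁, ← e₂]
    have heq : ∀ {a b a' b' : FreeSemigroup (Fin n)}, a = a' → b = b' →
        (FreeSemigroup.lift f a = FreeSemigroup.lift f b ↔
          FreeSemigroup.lift f a' = FreeSemigroup.lift f b') := by
      rintro _ _ _ _ rfl rfl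
      rfl
    refine heq (FreeSemigroup.ext rfl ?_) (FreeSemigroup.ext rfl ?_) <;> simp

end TriangularPresentation

/-! ### Transfer of decidability and the theorem -/

theorem GroupDecidableWordProblem.of_mulEquiv {G : Type u} {K : Type v} [Group G] [Group K]
    (e : G ≃* K) (h : GroupDecidableWordProblem G) : GroupDecidableWordProblem K := by
  obtain ⟨n, f, hf, hdec⟩ := h
  refine ⟨n, e ∘ f, ?_, ?_⟩
  · rw [Set.range_comp]
    have := (MonoidHom.map_closure e.toMonoidHom (Set.range f)).symm
    refine this.trans ?_
    rw [hf]
    exact Subgroup.map_top_of_surjective _ e.surjective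
  · convert hdec using 2 with w
    have : FreeGroup.lift (e ∘ f) = e.toMonoidHom.comp (FreeGroup.lift f) :=
      FreeGroup.ext_hom _ _ fun a => by simp
    rw [this]
    exact EmbeddingLike.map_eq_one_iff (f := e)

theorem GroupDecidableWordProblem.of_subsingleton (G : Type u) [Group G] [Subsingleton G] :
    GroupDecidableWordProblem G := by
  refine ⟨0, Fin.elim0, Subsingleton.elim _ _, ?_⟩
  refine ⟨fun _ => Decidable.isTrue (Subsingleton.elim _ _), ?_⟩
  exact (Computable.const true).of_eq fun _ => by simp [Subsingleton.elim _ (1 : G)]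

theorem theorem4p3 (G : Type u) [Group G] [Group.IsFinitelyPresented G]
    (hG : GroupDecidableWordProblem G) (H : Subgroup G) (hH : H.FG)
    (hmem : ¬ DecidableMembershipProblem H) :
    Nonempty (TriangularPresentation.{u, v} G H) ∧
    ∀ P : TriangularPresentation.{u, v} G H,
      Finite P.Band ∧ (∀ x : P.Band, x * x = x) ∧
      (∀ e : Idempotents (IG P.Band),
        (Nontrivial (MaximalSubgroup e) → Nonempty (MaximalSubgroup e ≃* G)) ∧
        GroupDecidableWordProblem (MaximalSubgroup e)) ∧
      ¬ SemigroupDecidableWordProblem (IG P.Band) := by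
  refine ⟨nonempty_triangularPresentation G H hH, fun P =>
    ⟨P.finite_band, P.band_mul_self, fun e => ?_, fun h => hmem (P.decidableMembershipProblem h)⟩⟩
  rcases TriangularPresentation.subsingleton_or_nonempty_mulEquiv e with h | ⟨⟨φ⟩⟩
  · exact ⟨fun h' => (not_subsingleton _ h).elim, .of_subsingleton _⟩
  · exact ⟨fun _ => ⟨φ⟩, hG.of_mulEquiv φ.symm⟩
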